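/- For integers $k \ge 1$ and $n \ge 2k+1$, the Kneser graph $K(n,k)$ is the graph whose vertices are the $k$-element subsets of $\{1,\ldots,n\}$, two of them being joined by an edge exactly when they are disjoint. Theorem. For every integer $k \ge 3$, the odd graph $O_k = K(2k+1,k)$ has a Hamilton cycle, that is, a cycle in $O_k$ that visits every vertex exactly once. -/

import Mathlib

/-- The Kneser graph `K(n, k)`: its vertices are the `k`-element subsets of an `n`-element
ground set, and two distinct vertices are adjacent when they are disjoint.  (For `k ≥ 1`
disjoint `k`-element sets are automatically distinct; the clause `s ≠ t` only matters for
`k = 0`, where it prevents a loop.) -/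
def kneserGraph (n k : ℕ) : SimpleGraph {s : Finset (Fin n) // s.card = k} where
  Adj s t := s ≠ t ∧ Disjoint s.1 t.1
  symm := ⟨fun _ _ h => ⟨h.1.symm, h.2.symm⟩⟩
  loopless := ⟨fun _ h => h.1 rfl⟩

/-- The odd graph `O_k = K(2k+1, k)`. -/
abbrev oddGraph (k : ℕ) : SimpleGraph {s : Finset (Fin (2 * k + 1)) // s.card = k} :=
  kneserGraph (2 * k + 1) k

/-!
# Hamilton cycles in odd graphs

The proof joins the cycles of an explicit cycle factor of `O_k` to a single cycle.

A vertex of `O_k` is encoded by a word of length `2k`: the indicator word of the set without its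
last position, complemented if the set contains the last element (`toWord`).  The words that occur
are those with `k` or `k + 1` ones, and two vertices are adjacent when their words differ in one
letter or are complementary (`adj_of_near`).

*The cycle factor.*  Every binary tree `x` with `k` nodes has a Dyck word `dyck x` and a list
`states x` of `2k + 1` words, from `dyck x` to its complement, in which consecutive words differ in
one letter; so the list closes up to a cycle.  Decomposing lattice paths at first and last passages
shows that every word lies on one of these cycles (`exists_mem_states`).  There are
`(2k + 1) * catalan k` vertices, which is also the total length of the lists, so by counting the
cycles are disjoint and simple (`nodup_allStates`).

*Joining.*  If edges of three or four cycles alternate with edges of the graph in a `6`-cycle or an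
`8`-cycle, then taking the symmetric difference joins these cycles to one (`Triple.join`,
`Quad.join`).  This can be repeated along a tree-like system of hyperedges, as long as no edge of
the cycle factor is used twice.  The inductive predicate `Hooked` records the trees that are joined
and the edges that are used up; `Hooked.exists_list` turns it into a list of words.  So it suffices
to join all trees with `k` nodes.

*Recursion.*  The list of a tree `u △ v` contains copies of the lists of `u` and `v`.  Therefore,
if the trees with `i` nodes can be joined, and those with `j` nodes, then so can the trees `u △ v`
with `i` nodes in `u` and `j` nodes in `v` (`Hooked.grid`).  The classes so obtained are attached to
the class with empty `u` by further hyperedges, mainly `triple_hub`, which attaches two consecutive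
classes at a time, and `quad_hub`.  The edges they need are available because some edges
(`Reserved`) are never used in the trees of smaller size, an invariant that the joining preserves
(`Joinable`).  The two trees with two nodes cannot be joined, as `O_2` is the Petersen graph; so a
class in which `u` or `v` has two nodes comes in two parts.  The parts cause the start and the end
of the recursion, `stage_two`, `stage_three` and `Stage.finish`, and for `3 ≤ k ≤ 6` the hyperedges
are chosen individually.
-/

namespace OddGraph

open scoped BinaryTree

/-! ### Words and Dyck words -/

/-- Binary trees, the index set of the cycle factor. -/
abbrev Shape := BinaryTree Unit

/-- Words over `{0, 1}`, with `true` for `1`; as lattice paths, `true` is an up-step. -/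
abbrev Word := List Bool

/-- The bitwise complement of a word. -/
def comp (w : Word) : Word := w.map not

/-- The reversed complement of a word: the mirror image of the lattice path. -/
def rc (w : Word) : Word := (comp w).reverse

/-- The final height of a word, read as a lattice path. -/
def height (w : Word) : ℤ := (w.map fun b => if b then (1 : ℤ) else -1).sum

@[simp] theorem comp_nil : comp [] = [] := rfl
@[simp] theorem comp_cons (b : Bool) (w : Word) : comp (b :: w) = (!b) :: comp w := rfl
@[simp] theorem comp_append (v w : Word) : comp (v ++ w) = comp v ++ comp w := by simp [comp]
@[simp] theorem comp_reverse (w : Word) : comp w.reverse = (comp w).reverse := by simp [comp]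
@[simp] theorem comp_comp (w : Word) : comp (comp w) = w := by
  induction w with
  | nil => rfl
  | cons b w ih => simp [ih]
@[simp] theorem length_comp (w : Word) : (comp w).length = w.length := by simp [comp]

@[simp] theorem rc_nil : rc [] = [] := rfl
@[simp] theorem rc_cons (b : Bool) (w : Word) : rc (b :: w) = rc w ++ [!b] := by simp [rc]
@[simp] theorem rc_append (v w : Word) : rc (v ++ w) = rc w ++ rc v := by simp [rc]
@[simp] theorem rc_rc (w : Word) : rc (rc w) = w := by simp [rc]
@[simp] theorem rc_comp (w : Word) : rc (comp w) = w.reverse := by simp [rc]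
@[simp] theorem comp_rc (w : Word) : comp (rc w) = w.reverse := by simp [rc]
@[simp] theorem reverse_rc (w : Word) : (rc w).reverse = comp w := by simp [rc]
@[simp] theorem length_rc (w : Word) : (rc w).length = w.length := by simp [rc]

@[simp] theorem height_nil : height [] = 0 := rfl
@[simp] theorem height_cons (b : Bool) (w : Word) :
    height (b :: w) = (if b then 1 else -1) + height w := by simp [height]
@[simp] theorem height_append (v w : Word) : height (v ++ w) = height v + height w := by
  simp [height]
@[simp] theorem height_reverse (w : Word) : height w.reverse = height w := by
  simp [height, List.sum_reverse]
@[simp] theorem height_comp (w : Word) : height (comp w) = -height w := by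
  induction w with
  | nil => rfl
  | cons b w ih => cases b <;> simp [ih] <;> ring
@[simp] theorem height_rc (w : Word) : height (rc w) = -height w := by simp [rc]

/-- The bijection from binary trees to Dyck words.  The left subtree is drawn mirrored, so that
passing to a left subtree interchanges the roles of the two reading directions. -/
def dyck : Shape → Word
  | .nil => []
  | .node _ u v => true :: rc (dyck u) ++ false :: dyck v

@[simp] theorem dyck_nil : dyck .nil = [] := rfl
@[simp] theorem dyck_node (u v : Shape) :
    dyck (u △ v) = true :: (rc (dyck u) ++ false :: dyck v) := rfl

@[simp] theorem length_dyck (x : Shape) : (dyck x).length = 2 * x.numNodes := by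
  induction x with
  | nil => rfl
  | node _ u v hu hv =>
    change (dyck (u △ v)).length = _
    simp [hu, hv]; ring

@[simp] theorem height_dyck (x : Shape) : height (dyck x) = 0 := by
  induction x with
  | nil => rfl
  | node _ u v hu hv =>
    change height (dyck (u △ v)) = _
    simp [hu, hv]

/-- A word is a Dyck word if it encodes a binary tree.  That these are the balanced words with
nonnegative prefix heights is not needed. -/
def IsDyck (w : Word) : Prop := ∃ x, dyck x = w

theorem isDyck_nil : IsDyck [] := ⟨.nil, rfl⟩

theorem IsDyck.height_eq {w : Word} (h : IsDyck w) : height w = 0 := by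
  obtain ⟨x, rfl⟩ := h
  simp

theorem IsDyck.append {v w : Word} (hv : IsDyck v) (hw : IsDyck w) : IsDyck (v ++ w) := by
  obtain ⟨x, rfl⟩ := hv
  obtain ⟨y, rfl⟩ := hw
  induction x with
  | nil => exact ⟨y, rfl⟩
  | node _ u v _ hv =>
    obtain ⟨z, hz⟩ := hv
    refine ⟨u △ z, ?_⟩
    change _ = dyck (u △ v) ++ _
    simp [hz]

theorem IsDyck.rc {w : Word} (hw : IsDyck w) : IsDyck (rc w) := by
  obtain ⟨x, rfl⟩ := hw
  induction x with
  | nil => exact ⟨.nil, rfl⟩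
  | node _ u v hu hv =>
    obtain ⟨y, hy⟩ := hu
    have h : IsDyck (true :: dyck u ++ [false]) := ⟨y △ .nil, by simp [hy]⟩
    have := hv.append h
    change IsDyck (OddGraph.rc (dyck (u △ v)))
    simpa using this

theorem IsDyck.wrap {v w : Word} (hv : IsDyck v) (hw : IsDyck w) :
    IsDyck (true :: v ++ false :: w) := by
  obtain ⟨x, hx⟩ := hv.rc
  obtain ⟨y, rfl⟩ := hw
  exact ⟨x △ y, by simp [hx]⟩

/-- Decomposition at the first passage to height `-1`. -/
theorem exists_first_descent (w : Word) (h : height w ≤ -1) :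
    ∃ d r, IsDyck d ∧ w = d ++ false :: r := by
  induction hn : w.length using Nat.strong_induction_on generalizing w with
  | _ n ih =>
    match w, h with
    | [], h => simp at h
    | false :: r, _ => exact ⟨[], r, isDyck_nil, rfl⟩
    | true :: m, h =>
      simp only [height_cons, if_true] at h
      simp only [List.length_cons] at hn
      obtain ⟨d₁, m', hd₁, rfl⟩ := ih m.length (by omega) m (by omega) rfl
      simp [hd₁.height_eq] at h
      simp only [List.length_append, List.length_cons] at hn
      obtain ⟨d₂, r, hd₂, rfl⟩ := ih m'.length (by omega) m' (by omega) rfl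
      exact ⟨_, r, hd₁.wrap hd₂, by simp⟩

/-- Decomposition at the first passage to height `1`. -/
theorem exists_first_ascent (w : Word) (h : 1 ≤ height w) :
    ∃ d r, IsDyck d ∧ w = comp d ++ true :: r := by
  obtain ⟨d, r, hd, h'⟩ := exists_first_descent (comp w) (by simp; omega)
  refine ⟨d, comp r, hd, ?_⟩
  have := congrArg comp h'
  simpa using this

/-- Decomposition at the last up-step that starts at height `height w - 1`. -/
theorem exists_last_ascent (w : Word) (h : 1 ≤ height w) :
    ∃ r d, IsDyck d ∧ w = r ++ true :: d := by
  obtain ⟨d, r, hd, h'⟩ := exists_first_descent (rc w) (by simp; omega)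
  refine ⟨rc r, rc d, hd.rc, ?_⟩
  have := congrArg rc h'
  simpa using this

/-- Decomposition at the last down-step that starts at height `height w + 1`. -/
theorem exists_last_descent (w : Word) (h : height w ≤ -1) :
    ∃ r d, IsDyck d ∧ w = r ++ false :: comp d := by
  obtain ⟨d, r, hd, h'⟩ := exists_first_descent w.reverse (by simpa using h)
  refine ⟨r.reverse, rc d, hd.rc, ?_⟩
  have := congrArg List.reverse h'
  simpa using this

/-- A balanced word is a Dyck word or has a last excursion below the axis. -/
theorem isDyck_or_exists_last_flaw (m : Word) (h : height m = 0) :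
    IsDyck m ∨ ∃ w d₁ d₂, height w = 0 ∧ IsDyck d₁ ∧ IsDyck d₂ ∧
      m = w ++ false :: (comp d₁ ++ true :: d₂) := by
  induction hn : m.length using Nat.strong_induction_on generalizing m with
  | _ n ih =>
    rcases List.eq_nil_or_concat m with rfl | ⟨m', b, rfl⟩
    · exact .inl isDyck_nil
    · simp only [List.concat_eq_append, height_append, height_cons, height_nil] at h
      cases b with
      | true =>
        obtain ⟨r, d, hd, rfl⟩ := exists_last_descent m' (by simp at h; omega)
        simp [hd.height_eq] at h
        exact .inr ⟨r, d, [], by omega, hd, isDyck_nil, by simp⟩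
      | false =>
        obtain ⟨r, d, hd, rfl⟩ := exists_last_ascent m' (by simp at h; omega)
        simp [hd.height_eq] at h
        have hl : IsDyck (true :: d ++ [false]) := hd.wrap isDyck_nil
        simp at hn
        rcases ih r.length (by omega) r (by omega) rfl with hr | ⟨w, d₁, d₂, hw, h₁, h₂, rfl⟩
        · left
          simpa using hr.append hl
        · exact .inr ⟨w, d₁, _, hw, h₁, h₂.append hl, by simp⟩

/-! ### The cycle factor -/

/-- The word in `states (u △ v)` that comes from the word `w` in `states u`. -/
def liftL (v : Shape) (w : Word) : Word := true :: (rc w ++ true :: dyck v)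

/-- The word in `states (u △ v)` that comes from the word `w` in `states v`. -/
def liftR (u : Shape) (w : Word) : Word := false :: ((dyck u).reverse ++ true :: w)

/-- The path of words that starts at `dyck x`, ends at its complement and flips every position
once: the closing bracket of the first excursion, then the positions inside this excursion, then
its opening bracket, and then the rest of the word. -/
def states : Shape → List Word
  | .nil => [[]]
  | .node _ u v => dyck (u △ v) :: ((states u).map (liftL v) ++ (states v).map (liftR u))

@[simp] theorem states_nil : states .nil = [[]] := rfl
@[simp] theorem states_node (u v : Shape) :
    states (u △ v) = dyck (u △ v) :: ((states u).map (liftL v) ++ (states v).map (liftR u)) := rfl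

theorem length_states (x : Shape) : (states x).length = 2 * x.numNodes + 1 := by
  induction x with
  | nil => rfl
  | node _ u v hu hv =>
    change (states (u △ v)).length = _
    simp [hu, hv]; ring

theorem length_of_mem_states {x : Shape} {w : Word} (h : w ∈ states x) :
    w.length = 2 * x.numNodes := by
  induction x generalizing w with
  | nil => simp at h; simp [h]
  | node _ u v hu hv =>
    change w ∈ states (u △ v) at h
    simp only [states_node, List.mem_cons, List.mem_append, List.mem_map] at h
    rcases h with rfl | ⟨w, hw, rfl⟩ | ⟨w, hw, rfl⟩
    · simp; ring
    · simp [liftL, hu hw]; ring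
    · simp [liftR, hv hw]; ring

theorem head?_states (x : Shape) : (states x).head? = some (dyck x) := by
  cases x with
  | nil => rfl
  | node _ u v => rfl

theorem getLast?_states (x : Shape) : (states x).getLast? = some (comp (dyck x)) := by
  induction x with
  | nil => rfl
  | node _ u v hu hv =>
    change (states (u △ v)).getLast? = some (comp (dyck (u △ v)))
    simp [List.getLast?_cons, List.getLast?_append, hv, liftR]

/-- Every word of final height `0` or `2` occurs on one of the paths.  The map `liftR`
is inverted by cutting at the first return to height `0`, and `liftL` by cutting at an up-step that
is followed by a Dyck word. -/
theorem exists_mem_states (w : Word) (h : height w = 0 ∨ height w = 2) : ∃ x, w ∈ states x := by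
  induction hn : w.length using Nat.strong_induction_on generalizing w with
  | _ n ih =>
    -- a word ending in an up-step followed by a Dyck word comes from a left subtree
    have left : ∀ m d, w = true :: (m ++ true :: d) → IsDyck d → ∃ x, w ∈ states x := by
      rintro m d rfl hd
      obtain ⟨v, rfl⟩ := hd
      simp at h hn
      obtain ⟨u, hu⟩ := ih (rc m).length (by simp; omega) (rc m) (by simp; omega) rfl
      refine ⟨u △ v, ?_⟩
      simp only [states_node, List.mem_cons, List.mem_append, List.mem_map]
      exact .inr (.inl ⟨_, hu, by simp [liftL]⟩)
    match w, h with
    | [], _ => exact ⟨.nil, by simp⟩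
    | false :: m, h =>
      simp only [height_cons] at h
      obtain ⟨d, r, hd, rfl⟩ := exists_first_ascent m (by simp at h; omega)
      obtain ⟨u, hu⟩ := hd.rc
      simp [hd.height_eq] at h hn
      obtain ⟨v, hv⟩ := ih r.length (by omega) r (by omega) rfl
      refine ⟨u △ v, ?_⟩
      simp only [states_node, List.mem_cons, List.mem_append, List.mem_map]
      exact .inr (.inr ⟨_, hv, by simp [liftR, hu]⟩)
    | true :: m, .inr h =>
      obtain ⟨r, d, hd, rfl⟩ := exists_last_ascent m (by simp at h; omega)
      exact left r d rfl hd
    | true :: m, .inl h =>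
      obtain ⟨d, m', hd, rfl⟩ := exists_first_descent m (by simp at h; omega)
      simp [hd.height_eq] at h
      rcases isDyck_or_exists_last_flaw m' (by omega) with hm | ⟨w', d₁, d₂, _, _, h₂, rfl⟩
      · obtain ⟨x, hx⟩ := hd.wrap hm
        refine ⟨x, ?_⟩
        have := List.mem_of_mem_head? (head?_states x)
        rw [hx] at this
        simpa using this
      · exact left (d ++ false :: (w' ++ false :: comp d₁)) d₂ (by simp) h₂

/-! ### Words and vertices of the odd graph -/

/-- The vertices of the odd graph `O_k`. -/
abbrev Vertex (k : ℕ) := {s : Finset (Fin (2 * k + 1)) // s.card = k}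

/-- The word of a vertex: the indicator word of the set on the first `2k` elements, complemented
if the set contains the last element. -/
def toWord {k : ℕ} (s : Vertex k) : Word :=
  List.ofFn fun i : Fin (2 * k) => xor (decide (i.castSucc ∈ s.1)) (decide (Fin.last _ ∈ s.1))

theorem length_toWord {k : ℕ} (s : Vertex k) : (toWord s).length = 2 * k := by simp [toWord]

theorem height_toWord {k : ℕ} (s : Vertex k) :
    height (toWord s) = if Fin.last _ ∈ s.1 then 2 else 0 := by
  have h : ∑ i : Fin (2 * k + 1), (if i ∈ s.1 then (1 : ℤ) else -1) = -1 := by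
    rw [Finset.sum_ite]
    have h₁ : (Finset.univ.filter (· ∈ s.1)).card = k := by
      rw [Finset.filter_mem_eq_inter, Finset.univ_inter, s.2]
    have h₂ : (Finset.univ.filter (· ∉ s.1)).card = k + 1 := by
      have := Finset.card_filter_add_card_filter_not (s := Finset.univ) (· ∈ s.1)
      simp only [Finset.card_univ, Fintype.card_fin] at this
      omega
    simp only [Finset.sum_const, h₁, h₂]
    simp
  rw [Fin.sum_univ_castSucc] at h
  simp only [height, toWord, List.map_ofFn, List.sum_ofFn, Function.comp_def]
  by_cases hl : Fin.last _ ∈ s.1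
  · simp only [hl, if_true] at h ⊢
    have : ∀ i : Fin (2 * k), (if (xor (decide (i.castSucc ∈ s.1)) (decide True)) = true
        then (1 : ℤ) else -1) = -(if i.castSucc ∈ s.1 then 1 else -1) := by
      intro i; by_cases hi : i.castSucc ∈ s.1 <;> simp [hi]
    simp only [this, Finset.sum_neg_distrib]
    omega
  · simp only [hl, if_false] at h ⊢
    simp only [decide_false, Bool.xor_false, decide_eq_true_eq]
    omega

theorem toWord_injective (k : ℕ) : Function.Injective (toWord (k := k)) := by
  intro s t h
  have hh := congrArg height h
  have hl : Fin.last _ ∈ s.1 ↔ Fin.last _ ∈ t.1 := by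
    rw [height_toWord, height_toWord] at hh
    by_cases h₁ : Fin.last _ ∈ s.1 <;> by_cases h₂ : Fin.last _ ∈ t.1 <;> simp_all
  have hi := List.ofFn_injective h
  apply Subtype.ext
  ext i
  refine Fin.lastCases hl (fun i => ?_) i
  have := congrFun hi i
  simpa [hl] using this

theorem card_vertex (k : ℕ) : Fintype.card (Vertex k) = (2 * k + 1) * catalan k := by
  have h₁ : Fintype.card (Vertex k) = (2 * k + 1).choose k := by
    rw [Fintype.card_finset_len, Fintype.card_fin]
  have h₂ := Nat.add_one_mul_choose_eq (2 * k) k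
  have h₃ := succ_mul_catalan_eq_centralBinom k
  have h₄ : (2 * k + 1).choose (k + 1) = (2 * k + 1).choose k :=
    Nat.choose_symm_half k
  rw [Nat.centralBinom_eq_two_mul_choose] at h₃
  rw [h₁]
  apply Nat.eq_of_mul_eq_mul_right (Nat.succ_pos k)
  simp only [Nat.succ_eq_add_one] at *
  rw [← h₄, ← h₂, ← h₃]
  ring

/-- All states of all trees with `k` nodes. -/
noncomputable def allStates (k : ℕ) : List Word :=
  (BinaryTree.treesOfNumNodesEq k).toList.flatMap states

theorem mem_allStates {k : ℕ} {w : Word} :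
    w ∈ allStates k ↔ ∃ x : Shape, x.numNodes = k ∧ w ∈ states x := by
  simp [allStates, BinaryTree.mem_treesOfNumNodesEq]

theorem length_allStates (k : ℕ) : (allStates k).length = (2 * k + 1) * catalan k := by
  have : ((BinaryTree.treesOfNumNodesEq k).toList.map fun x => (states x).length) =
      (BinaryTree.treesOfNumNodesEq k).toList.map fun _ => 2 * k + 1 := by
    refine List.map_congr_left fun x hx => ?_
    rw [Finset.mem_toList, BinaryTree.mem_treesOfNumNodesEq] at hx
    rw [length_states, hx]
  rw [allStates, List.length_flatMap, this]
  simp [BinaryTree.treesOfNumNodesEq_card_eq_catalan, mul_comm]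

theorem toWord_mem_allStates {k : ℕ} (s : Vertex k) : toWord s ∈ allStates k := by
  obtain ⟨x, hx⟩ := exists_mem_states (toWord s) (by rw [height_toWord]; split_ifs <;> simp)
  have h₁ := length_of_mem_states hx
  rw [length_toWord] at h₁
  exact mem_allStates.2 ⟨x, by omega, hx⟩

theorem image_toWord_subset (k : ℕ) :
    Finset.univ.image (toWord (k := k)) ⊆ (allStates k).toFinset := by
  intro w hw
  obtain ⟨s, _, rfl⟩ := Finset.mem_image.1 hw
  exact List.mem_toFinset.2 (toWord_mem_allStates s)

theorem card_image_toWord (k : ℕ) :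
    (Finset.univ.image (toWord (k := k))).card = (allStates k).length := by
  rw [Finset.card_image_of_injective _ (toWord_injective k), Finset.card_univ, card_vertex,
    length_allStates]

/-- By counting, no word occurs twice among the states. -/
theorem nodup_allStates (k : ℕ) : (allStates k).Nodup := by
  have h₁ := Finset.card_le_card (image_toWord_subset k)
  rw [card_image_toWord] at h₁
  have h₂ := List.toFinset_card_le (allStates k)
  exact Multiset.coe_nodup.1 (Multiset.toFinset_card_eq_card_iff_nodup.1 (le_antisymm h₂ h₁))

theorem exists_toWord_eq {x : Shape} {w : Word} (hw : w ∈ states x) :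
    ∃ s : Vertex x.numNodes, toWord s = w := by
  have h : Finset.univ.image (toWord (k := x.numNodes)) = (allStates x.numNodes).toFinset := by
    refine Finset.eq_of_subset_of_card_le (image_toWord_subset _) ?_
    rw [card_image_toWord]
    exact List.toFinset_card_le _
  have hw' : w ∈ (allStates x.numNodes).toFinset :=
    List.mem_toFinset.2 (mem_allStates.2 ⟨x, rfl, hw⟩)
  rw [← h] at hw'
  obtain ⟨s, _, hs⟩ := Finset.mem_image.1 hw'
  exact ⟨s, hs⟩

theorem nodup_states (x : Shape) : (states x).Nodup :=
  (List.nodup_flatMap.1 (nodup_allStates x.numNodes)).1 x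
    (by simp [BinaryTree.mem_treesOfNumNodesEq])

/-- Distinct trees have disjoint paths. -/
theorem eq_of_mem_states {x y : Shape} {w : Word} (hx : w ∈ states x) (hy : w ∈ states y) :
    x = y := by
  have hxy : x.numNodes = y.numNodes := by
    have := length_of_mem_states hx
    have := length_of_mem_states hy
    omega
  by_contra hne
  have h := (List.nodup_flatMap.1 (nodup_allStates x.numNodes)).2
  have : Std.Symm (Function.onFun List.Disjoint states) := ⟨fun _ _ h => List.disjoint_comm.1 h⟩
  exact h.forall (by simp [BinaryTree.mem_treesOfNumNodesEq])
    (by simp [BinaryTree.mem_treesOfNumNodesEq, hxy]) hne hx hy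

/-! ### Adjacency of words -/

/-- `Flip p q`: the word `q` arises from `p` by changing one letter. -/
def Flip (p q : Word) : Prop := ∃ s b t, p = s ++ b :: t ∧ q = s ++ (!b) :: t

theorem Flip.symm {p q : Word} (h : Flip p q) : Flip q p := by
  obtain ⟨s, b, t, rfl, rfl⟩ := h
  exact ⟨s, !b, t, rfl, by simp⟩

theorem Flip.cons {p q : Word} (c : Bool) (h : Flip p q) : Flip (c :: p) (c :: q) := by
  obtain ⟨s, b, t, rfl, rfl⟩ := h
  exact ⟨c :: s, b, t, rfl, rfl⟩

theorem Flip.append_left {p q : Word} (v : Word) (h : Flip p q) : Flip (v ++ p) (v ++ q) := by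
  induction v with
  | nil => exact h
  | cons c v ih => exact ih.cons c

theorem Flip.append_right {p q : Word} (v : Word) (h : Flip p q) : Flip (p ++ v) (q ++ v) := by
  obtain ⟨s, b, t, rfl, rfl⟩ := h
  exact ⟨s, b, t ++ v, by simp, by simp⟩

theorem Flip.head (b c : Bool) (t : Word) (h : c = !b) : Flip (b :: t) (c :: t) :=
  ⟨[], b, t, rfl, by simp [h]⟩

theorem Flip.rc {p q : Word} (h : Flip p q) : Flip (rc p) (rc q) := by
  obtain ⟨s, b, t, rfl, rfl⟩ := h
  exact ⟨OddGraph.rc t, !b, OddGraph.rc s, by simp, by simp⟩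

theorem Flip.liftL {p q : Word} (v : Shape) (h : Flip p q) : Flip (liftL v p) (liftL v q) :=
  (h.rc.append_right _).cons _

theorem Flip.liftR {p q : Word} (u : Shape) (h : Flip p q) : Flip (liftR u p) (liftR u q) :=
  (((h.cons _).append_left _).cons _)

/-- Words that represent adjacent vertices of the odd graph. -/
def Near (p q : Word) : Prop := Flip p q ∨ q = comp p

theorem Near.symm {p q : Word} (h : Near p q) : Near q p := by
  rcases h with h | rfl
  · exact .inl h.symm
  · exact .inr (by simp)

theorem getElem?_toWord {k : ℕ} (s : Vertex k) (i : Fin (2 * k)) :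
    (toWord s)[(i : ℕ)]? =
      some (xor (decide (i.castSucc ∈ s.1)) (decide (Fin.last _ ∈ s.1))) := by
  simp [toWord]

theorem disjoint_of_flip {k : ℕ} {s t : Vertex k} (h : Flip (toWord s) (toWord t))
    (hs : Fin.last _ ∉ s.1) : Disjoint s.1 t.1 := by
  have h₁ := height_toWord s
  have h₂ := height_toWord t
  obtain ⟨p, b, q, hp, hq⟩ := h
  have hb : b = false ∧ Fin.last _ ∈ t.1 := by
    rw [hp] at h₁
    rw [hq] at h₂
    cases b <;> by_cases ht : Fin.last _ ∈ t.1 <;> simp [hs, ht] at h₁ h₂ ⊢ <;> omega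
  obtain ⟨rfl, ht⟩ := hb
  rw [Finset.disjoint_left]
  intro i his hit
  induction i using Fin.lastCases with
  | last => exact hs his
  | cast i =>
    have h₃ := getElem?_toWord s i
    have h₄ := getElem?_toWord t i
    simp only [his, hs, hit, ht, decide_true, decide_false, Bool.xor_false, Bool.xor_true,
      Bool.not_true] at h₃ h₄
    rw [hp, List.getElem?_append] at h₃
    rw [hq, List.getElem?_append] at h₄
    split_ifs at h₃ h₄ with hlt
    · simp [h₃] at h₄
    · rw [List.getElem?_cons] at h₃ h₄
      split_ifs at h₃ h₄ with h0
      · simp at h₃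
      · simp [h₃] at h₄

theorem adj_of_near {k : ℕ} (hk : 1 ≤ k) {s t : Vertex k} (h : Near (toWord s) (toWord t)) :
    (oddGraph k).Adj s t := by
  have main : Disjoint s.1 t.1 := by
    by_cases hs : Fin.last _ ∈ s.1
    · by_cases ht : Fin.last _ ∈ t.1
      · exfalso
        have h₁ := height_toWord s
        have h₂ := height_toWord t
        rcases h with ⟨p, b, q, hp, hq⟩ | h
        · rw [hp] at h₁
          rw [hq] at h₂
          cases b <;> simp [hs, ht] at h₁ h₂ <;> omega
        · rw [h, height_comp, h₁] at h₂
          simp [hs, ht] at h₂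
      · rcases h with h | h
        · exact (disjoint_of_flip h.symm ht).symm
        · have h₁ := height_toWord s
          have h₂ := height_toWord t
          rw [h, height_comp, h₁] at h₂
          simp [hs, ht] at h₂
    · rcases h with h | h
      · exact disjoint_of_flip h hs
      · have ht : Fin.last _ ∉ t.1 := by
          intro ht
          have h₁ := height_toWord s
          have h₂ := height_toWord t
          rw [h, height_comp, h₁] at h₂
          simp [hs, ht] at h₂
        rw [Finset.disjoint_left]
        intro i his hit
        induction i using Fin.lastCases with
        | last => exact hs his
        | cast i =>
          have h₃ := getElem?_toWord s i
          have h₄ := getElem?_toWord t i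
          rw [h, comp, List.getElem?_map, h₃] at h₄
          simp [hs, ht, his, hit] at h₄
  refine ⟨?_, main⟩
  rintro rfl
  have := s.2
  rw [disjoint_self, Finset.bot_eq_empty] at main
  simp [main] at this
  omega

/-! ### Edges of the cycle factor -/

/-- Names for the edges of the path `states (u △ v)`: `opening` is its first edge, `closing` leads
from the words of `u` to the words of `v`, and the other edges are inherited from `u` and `v`. -/
inductive Label
  | opening
  | closing
  | left (l : Label)
  | right (l : Label)

/-- `IsEdge x l p q`: the edge with name `l` of the path `states x` goes from `p` to `q`. -/
inductive IsEdge : Shape → Label → Word → Word → Prop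
  | opening (u v : Shape) : IsEdge (u △ v) .opening (dyck (u △ v)) (liftL v (dyck u))
  | closing (u v : Shape) : IsEdge (u △ v) .closing (liftL v (comp (dyck u))) (liftR u (dyck v))
  | left {u l p q} (v : Shape) (h : IsEdge u l p q) :
      IsEdge (u △ v) (.left l) (liftL v p) (liftL v q)
  | right {v l p q} (u : Shape) (h : IsEdge v l p q) :
      IsEdge (u △ v) (.right l) (liftR u p) (liftR u q)

theorem liftL_injective (v : Shape) : Function.Injective (liftL v) := by
  intro p q h
  simp only [liftL, List.cons.injEq, true_and, List.append_left_inj] at h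
  simpa using congrArg rc h

theorem liftR_injective (u : Shape) : Function.Injective (liftR u) := by
  intro p q h
  simpa [liftR] using h

/-- `Consec l a b`: the elements `a` and `b` are neighbours in the list `l`, in this order. -/
def Consec {α : Type*} (l : List α) (a b : α) : Prop := ∃ s t, l = s ++ a :: b :: t

theorem Consec.append_left {α : Type*} {l : List α} {a b : α} (h : Consec l a b) (m : List α) :
    Consec (m ++ l) a b := by
  obtain ⟨s, t, rfl⟩ := h
  exact ⟨m ++ s, t, by simp⟩

theorem Consec.append_right {α : Type*} {l : List α} {a b : α} (h : Consec l a b) (m : List α) :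
    Consec (l ++ m) a b := by
  obtain ⟨s, t, rfl⟩ := h
  exact ⟨s, t ++ m, by simp⟩

theorem Consec.cons {α : Type*} {l : List α} {a b : α} (h : Consec l a b) (c : α) :
    Consec (c :: l) a b := h.append_left [c]

theorem Consec.map {α β : Type*} {l : List α} {a b : α} (h : Consec l a b) (f : α → β) :
    Consec (l.map f) (f a) (f b) := by
  obtain ⟨s, t, rfl⟩ := h
  exact ⟨s.map f, t.map f, by simp⟩

theorem Consec.reverse {α : Type*} {l : List α} {a b : α} (h : Consec l a b) :
    Consec l.reverse b a := by
  obtain ⟨s, t, rfl⟩ := h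
  exact ⟨t.reverse, s.reverse, by simp⟩

theorem Consec.mem_left {α : Type*} {l : List α} {a b : α} (h : Consec l a b) : a ∈ l := by
  obtain ⟨s, t, rfl⟩ := h
  simp

theorem Consec.mem_right {α : Type*} {l : List α} {a b : α} (h : Consec l a b) : b ∈ l := by
  obtain ⟨s, t, rfl⟩ := h
  simp

theorem consec_append_of_getLast?_head? {α : Type*} {l m : List α} {a b : α}
    (hl : l.getLast? = some a) (hm : m.head? = some b) : Consec (l ++ m) a b := by
  obtain ⟨s, rfl⟩ := List.getLast?_eq_some_iff.1 hl
  obtain ⟨t, rfl⟩ := List.head?_eq_some_iff.1 hm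
  exact ⟨s, t, by simp⟩

/-- Neighbours in a concatenation are neighbours in one of the parts, or sit at the seam. -/
theorem consec_append {α : Type*} {l m : List α} {a b : α} (h : Consec (l ++ m) a b) :
    Consec l a b ∨ Consec m a b ∨ l.getLast? = some a ∧ m.head? = some b := by
  obtain ⟨s, t, h⟩ := h
  rcases List.append_eq_append_iff.1 h with ⟨c, rfl, rfl⟩ | ⟨c, rfl, hc⟩
  · exact .inr (.inl ⟨c, t, rfl⟩)
  · rcases c with _ | ⟨x, _ | ⟨y, c⟩⟩
    · exact .inr (.inl ⟨[], t, by simpa using hc.symm⟩)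
    · simp only [List.singleton_append, List.cons.injEq] at hc
      obtain ⟨rfl, rfl⟩ := hc
      exact .inr (.inr ⟨by simp, by simp⟩)
    · simp only [List.cons_append, List.cons.injEq] at hc
      obtain ⟨rfl, rfl, -⟩ := hc
      exact .inl ⟨s, c, rfl⟩

/-- In a list without repetitions neighbours occur in one order only. -/
theorem Consec.asymm {α : Type*} {l : List α} {a b : α} (hl : l.Nodup) (h : Consec l a b)
    (h' : Consec l b a) : False := by
  obtain ⟨s, t, rfl⟩ := h
  obtain ⟨s', t', h'⟩ := h'
  induction s generalizing s' with
  | nil =>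
    rcases s' with _ | ⟨x, _ | ⟨y, s'⟩⟩
    · simp at h' hl; grind
    · simp at h' hl; grind
    · simp at h' hl; grind
  | cons c s ih =>
    rcases s' with _ | ⟨x, s'⟩
    · simp at h' hl; grind
    · simp only [List.cons_append, List.cons.injEq] at h'
      exact ih (List.nodup_cons.1 hl).2 s' h'.2

theorem IsEdge.consec {x : Shape} {l : Label} {p q : Word} (h : IsEdge x l p q) :
    Consec (states x) p q := by
  induction h with
  | opening u v =>
    obtain ⟨t, ht⟩ := List.head?_eq_some_iff.1 (head?_states u)
    exact ⟨[], t.map (liftL v) ++ (states v).map (liftR u), by simp [ht]⟩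
  | closing u v =>
    refine (consec_append_of_getLast?_head? ?_ ?_).cons _
    · simp [getLast?_states]
    · simp [head?_states]
  | left v _ ih => exact ((ih.map _).append_right _).cons _
  | right u _ ih => exact ((ih.map _).append_left _).cons _

theorem IsEdge.mem_left {x : Shape} {l : Label} {p q : Word} (h : IsEdge x l p q) :
    p ∈ states x := h.consec.mem_left

theorem IsEdge.mem_right {x : Shape} {l : Label} {p q : Word} (h : IsEdge x l p q) :
    q ∈ states x := h.consec.mem_right

theorem IsEdge.ne_comp_dyck {x : Shape} {l : Label} {p q : Word} (h : IsEdge x l p q) :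
    p ≠ comp (dyck x) := by
  rintro rfl
  obtain ⟨s, t, hst⟩ := h.consec
  have h₁ := getLast?_states x
  have h₂ := nodup_states x
  obtain ⟨r, hr⟩ := List.getLast?_eq_some_iff.1 h₁
  have h₃ : comp (dyck x) ∈ q :: t := by
    have : (q :: t).getLast? = some (comp (dyck x)) := by
      rw [hst] at h₁
      simpa [List.getLast?_append, List.getLast?_cons] using h₁
    exact List.mem_of_getLast? this
  rw [hst] at h₂
  exact (List.nodup_cons.1 (List.nodup_append.1 h₂).2.1).1 h₃

theorem dyck_ne_liftL {u v : Shape} {w : Word} (hw : w ∈ states u) :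
    dyck (u △ v) ≠ liftL v w := by
  intro h
  simp only [dyck_node, liftL, List.cons.injEq, true_and] at h
  have := List.append_inj_right h (by simp [length_of_mem_states hw])
  simp at this

/-- An edge of `states x` is determined by its first endpoint. -/
theorem IsEdge.label_unique {x : Shape} {l l' : Label} {p q q' : Word} (h : IsEdge x l p q)
    (h' : IsEdge x l' p q') : l = l' := by
  induction h generalizing l' q' with
  | opening u v =>
    generalize hp : dyck (u △ v) = p at h'
    cases h' with
    | opening => rfl
    | closing =>
      exact (dyck_ne_liftL (List.mem_of_getLast? (getLast?_states u)) hp).elim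
    | left _ h => exact (dyck_ne_liftL h.mem_left hp).elim
    | right _ h => simp [liftR] at hp
  | closing u v =>
    generalize hp : liftL v (comp (dyck u)) = p at h'
    cases h' with
    | opening => exact (dyck_ne_liftL (List.mem_of_getLast? (getLast?_states u)) hp.symm).elim
    | closing => rfl
    | left _ h => exact (h.ne_comp_dyck (liftL_injective v hp).symm).elim
    | right _ h => simp [liftR, liftL] at hp
  | @left u l p q v h ih =>
    generalize hp : liftL v p = p' at h'
    cases h' with
    | opening => exact (dyck_ne_liftL h.mem_left hp.symm).elim
    | closing => exact (h.ne_comp_dyck (liftL_injective v hp)).elim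
    | left _ h' =>
      obtain rfl := liftL_injective v hp
      rw [ih h']
    | right _ h => simp [liftR, liftL] at hp
  | @right v l p q u h ih =>
    generalize hp : liftR u p = p' at h'
    cases h' with
    | opening => simp [liftR] at hp
    | closing => simp [liftR, liftL] at hp
    | left _ h' => simp [liftR, liftL] at hp
    | right _ h' =>
      obtain rfl := liftR_injective u hp
      rw [ih h']

theorem IsEdge.flip {x : Shape} {l : Label} {p q : Word} (h : IsEdge x l p q) : Flip p q := by
  induction h with
  | opening u v => exact ⟨true :: rc (dyck u), false, dyck v, by simp, by simp [liftL]⟩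
  | closing u v => exact ⟨[], true, (dyck u).reverse ++ true :: dyck v, by simp [liftL],
      by simp [liftR]⟩
  | left v _ ih => exact ih.liftL v
  | right u _ ih => exact ih.liftR u

theorem isChain_states (x : Shape) : (states x).IsChain Flip := by
  induction x with
  | nil => exact .singleton _
  | node _ u v hu hv =>
    have h₁ : ((states u).map (liftL v)).IsChain Flip :=
      (List.isChain_map _).2 (hu.imp fun _ _ h => h.liftL v)
    have h₂ : ((states v).map (liftR u)).IsChain Flip :=
      (List.isChain_map _).2 (hv.imp fun _ _ h => h.liftR u)
    change (dyck (u △ v) :: _).IsChain Flip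
    refine List.isChain_cons.2 ⟨?_, List.isChain_append.2 ⟨h₁, h₂, ?_⟩⟩
    · intro y hy
      simp [List.head?_append, head?_states] at hy
      subst hy
      exact (IsEdge.opening u v).flip
    · intro p hp q hq
      simp [getLast?_states] at hp
      simp [head?_states] at hq
      subst hp hq
      exact (IsEdge.closing u v).flip

/-! ### Joining cycles -/

/-- `Hooked X U o`: the cycles of the trees in `X` have been joined, using up the edges in `U`.
For `o = none` the result is a single cycle, for `o = some (p, q)` it is a path from `p` to `q`.
All edges of the cycles of `X` that are not in `U` are still present. -/
inductive Hooked : Set Shape → Set (Shape × Label) → Option (Word × Word) → Prop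
  | single (x : Shape) : Hooked {x} ∅ none
  | cut {X U x l p q} (h : Hooked X U none) (hx : x ∈ X) (hl : (x, l) ∉ U) (he : IsEdge x l p q) :
      Hooked X (insert (x, l) U) (some (p, q))
  | swap {X U p q} (h : Hooked X U (some (p, q))) : Hooked X U (some (q, p))
  | glue {X U p q Y V r s} (h : Hooked X U (some (p, q))) (h' : Hooked Y V (some (r, s)))
      (hqr : Flip q r) (hXY : Disjoint X Y) : Hooked (X ∪ Y) (U ∪ V) (some (p, s))
  | close {X U p q} (h : Hooked X U (some (p, q))) (hpq : Flip q p) : Hooked X U none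
  | mono {X U V o} (h : Hooked X U o) (hUV : U ⊆ V) : Hooked X V o

section Lists

variable {α : Type*}

/-- `a` and `b` are neighbours in the list `l`, in either order. -/
def PathNbr (l : List α) (a b : α) : Prop := Consec l a b ∨ Consec l b a

/-- `a` and `b` are neighbours in the list `l`, read cyclically, in either order. -/
def CycleNbr (l : List α) (a b : α) : Prop :=
  PathNbr l a b ∨ (l.getLast? = some a ∧ l.head? = some b) ∨
    (l.getLast? = some b ∧ l.head? = some a)

theorem CycleNbr.symm {l : List α} {a b : α} (h : CycleNbr l a b) : CycleNbr l b a := by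
  rcases h with h | h | h
  · exact .inl h.symm
  · exact .inr (.inr h)
  · exact .inr (.inl h)

theorem PathNbr.reverse {l : List α} {a b : α} (h : PathNbr l a b) : PathNbr l.reverse a b :=
  h.symm.imp Consec.reverse Consec.reverse

theorem PathNbr.append_left {l : List α} {a b : α} (h : PathNbr l a b) (m : List α) :
    PathNbr (m ++ l) a b := h.imp (·.append_left m) (·.append_left m)

theorem PathNbr.append_right {l : List α} {a b : α} (h : PathNbr l a b) (m : List α) :
    PathNbr (l ++ m) a b := h.imp (·.append_right m) (·.append_right m)

theorem CycleNbr.rotate {l m : List α} {a b : α} (hl : l ≠ []) (hm : m ≠ [])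
    (h : CycleNbr (l ++ m) a b) : CycleNbr (m ++ l) a b := by
  have ends : ∀ {c d}, (l ++ m).getLast? = some c ∧ (l ++ m).head? = some d →
      Consec (m ++ l) c d := by
    rintro c d ⟨h₁, h₂⟩
    rw [List.getLast?_append_of_ne_nil _ hm] at h₁
    rw [List.head?_append_of_ne_nil _ hl] at h₂
    exact consec_append_of_getLast?_head? h₁ h₂
  have inner : ∀ {c d}, Consec (l ++ m) c d → CycleNbr (m ++ l) c d := by
    intro c d h
    rcases consec_append h with h | h | ⟨h₁, h₂⟩
    · exact .inl (.inl (h.append_left _))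
    · exact .inl (.inl (h.append_right _))
    · refine .inr (.inl ⟨?_, ?_⟩)
      · rw [List.getLast?_append_of_ne_nil _ hl, h₁]
      · rw [List.head?_append_of_ne_nil _ hm, h₂]
  rcases h with (h | h) | h | h
  · exact inner h
  · exact (inner h).symm
  · exact .inl (.inl (ends h))
  · exact .inl (.inr (ends h))

/-- `IsCyc R l`: the list `l` enumerates, without repetitions, a cycle for the relation `R`. -/
structure IsCyc (R : α → α → Prop) (l : List α) : Prop where
  nodup : l.Nodup
  isChain : l.IsChain R
  closed : ∃ a b, l.head? = some a ∧ l.getLast? = some b ∧ R b a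

theorem IsCyc.rotate {R : α → α → Prop} {l m : List α} (hl : l ≠ []) (hm : m ≠ [])
    (h : IsCyc R (l ++ m)) : IsCyc R (m ++ l) where
  nodup := List.nodup_append_comm.1 h.nodup
  isChain := by
    obtain ⟨a, b, h₁, h₂, h₃⟩ := h.closed
    obtain ⟨h₄, h₅, -⟩ := List.isChain_append.1 h.isChain
    rw [List.getLast?_append_of_ne_nil _ hm] at h₂
    rw [List.head?_append_of_ne_nil _ hl] at h₁
    refine List.isChain_append.2 ⟨h₅, h₄, fun x hx y hy => ?_⟩
    rw [h₂] at hx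
    rw [h₁] at hy
    cases hx
    cases hy
    exact h₃
  closed := by
    obtain ⟨b, hb⟩ : ∃ b, m.head? = some b := by
      cases m with
      | nil => exact (hm rfl).elim
      | cons b m => exact ⟨b, rfl⟩
    obtain ⟨a, ha⟩ : ∃ a, l.getLast? = some a := ⟨_, List.getLast?_eq_some_getLast hl⟩
    refine ⟨b, a, ?_, ?_, ?_⟩
    · rw [List.head?_append_of_ne_nil _ hm, hb]
    · rw [List.getLast?_append_of_ne_nil _ hl, ha]
    · exact (List.isChain_append.1 h.isChain).2.2 a ha b hb

theorem isChain_reverse {R : α → α → Prop} (hR : ∀ {a b}, R a b → R b a) {l : List α}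
    (h : l.IsChain R) : l.reverse.IsChain R :=
  List.isChain_reverse.2 (h.imp fun _ _ h => hR h)

/-- A cycle can be cut open at any of its edges. -/
theorem IsCyc.exists_cut {R : α → α → Prop} (hR : ∀ {a b}, R a b → R b a) {l : List α}
    (h : IsCyc R l) {p q : α} (hpq : CycleNbr l p q) :
    ∃ l' : List α, l'.Nodup ∧ (∀ a, a ∈ l' ↔ a ∈ l) ∧ l'.IsChain R ∧ l'.head? = some p ∧
      l'.getLast? = some q ∧ ∀ a b, CycleNbr l a b → ¬(a = p ∧ b = q) → ¬(a = q ∧ b = p) →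
        PathNbr l' a b := by
  -- first the edge from the last element of the list to the first one
  have base : ∀ (l : List α) (p q : α), IsCyc R l → l.head? = some p → l.getLast? = some q →
      ∃ l' : List α, l'.Nodup ∧ (∀ a, a ∈ l' ↔ a ∈ l) ∧ l'.IsChain R ∧ l'.head? = some p ∧
      l'.getLast? = some q ∧ ∀ a b, CycleNbr l a b → ¬(a = p ∧ b = q) → ¬(a = q ∧ b = p) →
        PathNbr l' a b := by
    intro l p q h hp hq
    refine ⟨l, h.nodup, fun _ => .rfl, h.isChain, hp, hq, ?_⟩
    rintro a b (h | ⟨h₁, h₂⟩ | ⟨h₁, h₂⟩) hn hn'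
    · exact h
    · rw [hq] at h₁
      rw [hp] at h₂
      cases h₁
      cases h₂
      exact (hn' ⟨rfl, rfl⟩).elim
    · rw [hq] at h₁
      rw [hp] at h₂
      cases h₁
      cases h₂
      exact (hn ⟨rfl, rfl⟩).elim
  have flip : ∀ p q, (∃ l' : List α, l'.Nodup ∧ (∀ a, a ∈ l' ↔ a ∈ l) ∧ l'.IsChain R ∧
      l'.head? = some p ∧ l'.getLast? = some q ∧ ∀ a b, CycleNbr l a b → ¬(a = p ∧ b = q) →
        ¬(a = q ∧ b = p) → PathNbr l' a b) →
      ∃ l' : List α, l'.Nodup ∧ (∀ a, a ∈ l' ↔ a ∈ l) ∧ l'.IsChain R ∧ l'.head? = some q ∧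
      l'.getLast? = some p ∧ ∀ a b, CycleNbr l a b → ¬(a = q ∧ b = p) → ¬(a = p ∧ b = q) →
        PathNbr l' a b := by
    rintro p q ⟨l', h₁, h₂, h₃, h₄, h₅, h₆⟩
    exact ⟨l'.reverse, List.nodup_reverse.2 h₁, by simpa using h₂, isChain_reverse hR h₃,
      by simpa using h₅, by simpa using h₄, fun a b h hn hn' => (h₆ a b h hn' hn).reverse⟩
  have inner : ∀ p q, Consec l q p → ∃ l' : List α, l'.Nodup ∧ (∀ a, a ∈ l' ↔ a ∈ l) ∧
      l'.IsChain R ∧ l'.head? = some p ∧ l'.getLast? = some q ∧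
      ∀ a b, CycleNbr l a b → ¬(a = p ∧ b = q) → ¬(a = q ∧ b = p) → PathNbr l' a b := by
    rintro p q ⟨s, t, rfl⟩
    have hl : s ++ q :: p :: t = (s ++ [q]) ++ p :: t := by simp
    rw [hl] at h ⊢
    obtain ⟨l', h₁, h₂, h₃, h₄, h₅, h₆⟩ :=
      base _ p q (h.rotate (by simp) (by simp)) (by simp)
        (by rw [List.getLast?_append_of_ne_nil _ (by simp)]; simp)
    refine ⟨l', h₁, fun a => (h₂ a).trans ?_, h₃, h₄, h₅,
      fun a b hab => h₆ a b (hab.rotate (by simp) (by simp))⟩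
    simp only [List.mem_append]
    tauto
  rcases hpq with (hpq | hpq) | ⟨h₁, h₂⟩ | ⟨h₁, h₂⟩
  · exact flip q p (inner q p hpq)
  · exact inner p q hpq
  · exact flip q p (base l q p h h₂ h₁)
  · exact base l p q h h₂ h₁

end Lists

theorem isCyc_states (x : Shape) : IsCyc Near (states x) where
  nodup := nodup_states x
  isChain := (isChain_states x).imp fun _ _ h => .inl h
  closed := ⟨_, _, head?_states x, getLast?_states x, .inr (by simp)⟩

/-- A `Hooked` configuration is realized by a list of words, which still contains all edges that
have not been used. -/
theorem Hooked.exists_list {X : Set Shape} {U : Set (Shape × Label)} {o : Option (Word × Word)}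
    (h : Hooked X U o) :
    (o = none → ∃ l, IsCyc Near l ∧ (∀ w, w ∈ l ↔ ∃ x ∈ X, w ∈ states x) ∧
      ∀ x ∈ X, ∀ m a b, (x, m) ∉ U → IsEdge x m a b → CycleNbr l a b) ∧
    (∀ p q, o = some (p, q) → ∃ l : List Word, l.Nodup ∧ l.IsChain Near ∧ l.head? = some p ∧
      l.getLast? = some q ∧ (∀ w, w ∈ l ↔ ∃ x ∈ X, w ∈ states x) ∧
      ∀ x ∈ X, ∀ m a b, (x, m) ∉ U → IsEdge x m a b → PathNbr l a b) := by
  induction h with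
  | single x =>
    refine ⟨fun _ => ⟨states x, isCyc_states x, by simp, ?_⟩, by simp⟩
    rintro y rfl m a b - he
    exact .inl (.inl he.consec)
  | @cut X U x l p q h hx hl he ih =>
    refine ⟨by simp, fun p' q' hpq => ?_⟩
    simp only [Option.some.injEq, Prod.mk.injEq] at hpq
    obtain ⟨rfl, rfl⟩ := hpq
    obtain ⟨k, h₁, h₂, h₃⟩ := ih.1 rfl
    obtain ⟨k', g₁, g₂, g₃, g₄, g₅, g₆⟩ := h₁.exists_cut Near.symm (h₃ x hx l p q hl he)
    refine ⟨k', g₁, g₃, g₄, g₅, fun w => (g₂ w).trans (h₂ w), fun y hy m a b hm he' => ?_⟩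
    rw [Set.mem_insert_iff, not_or] at hm
    refine g₆ a b (h₃ y hy m a b hm.2 he') ?_ ?_
    · rintro ⟨rfl, rfl⟩
      obtain rfl := eq_of_mem_states he.mem_left he'.mem_left
      obtain rfl := he.label_unique he'
      exact hm.1 rfl
    · rintro ⟨rfl, rfl⟩
      obtain rfl := eq_of_mem_states he.mem_left he'.mem_right
      exact he.consec.asymm (nodup_states _) he'.consec
  | @swap X U p q h ih =>
    refine ⟨by simp, fun p' q' hpq => ?_⟩
    simp only [Option.some.injEq, Prod.mk.injEq] at hpq
    obtain ⟨rfl, rfl⟩ := hpq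
    obtain ⟨k, h₁, h₂, h₃, h₄, h₅, h₆⟩ := ih.2 p q rfl
    exact ⟨k.reverse, List.nodup_reverse.2 h₁, isChain_reverse Near.symm h₂, by simpa using h₄,
      by simpa using h₃, by simpa using h₅,
      fun x hx m a b hm he => (h₆ x hx m a b hm he).reverse⟩
  | @glue X U p q Y V r s h h' hqr hXY ih ih' =>
    refine ⟨by simp, fun p' q' hpq => ?_⟩
    simp only [Option.some.injEq, Prod.mk.injEq] at hpq
    obtain ⟨rfl, rfl⟩ := hpq
    obtain ⟨k, h₁, h₂, h₃, h₄, h₅, h₆⟩ := ih.2 p q rfl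
    obtain ⟨k', g₁, g₂, g₃, g₄, g₅, g₆⟩ := ih'.2 r s rfl
    refine ⟨k ++ k', ?_, ?_, ?_, ?_, ?_, ?_⟩
    · refine List.nodup_append'.2 ⟨h₁, g₁, fun w hw hw' => ?_⟩
      obtain ⟨x, hx, hxw⟩ := (h₅ w).1 hw
      obtain ⟨y, hy, hyw⟩ := (g₅ w).1 hw'
      obtain rfl := eq_of_mem_states hxw hyw
      exact Set.disjoint_left.1 hXY hx hy
    · refine List.isChain_append.2 ⟨h₂, g₂, fun a ha b hb => ?_⟩
      rw [h₄] at ha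
      rw [g₃] at hb
      cases ha
      cases hb
      exact .inl hqr
    · simp [List.head?_append, h₃]
    · simp [List.getLast?_append, g₄]
    · intro w
      simp only [List.mem_append, h₅, g₅, Set.mem_union]
      grind
    · intro x hx m a b hm he
      rw [Set.mem_union, not_or] at hm
      rcases hx with hx | hx
      · exact (h₆ x hx m a b hm.1 he).append_right _
      · exact (g₆ x hx m a b hm.2 he).append_left _
  | @close X U p q h hpq ih =>
    refine ⟨fun _ => ?_, by simp⟩
    obtain ⟨k, h₁, h₂, h₃, h₄, h₅, h₆⟩ := ih.2 p q rfl
    exact ⟨k, ⟨h₁, h₂, p, q, h₃, h₄, .inl hpq⟩, h₅,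
      fun x hx m a b hm he => .inl (h₆ x hx m a b hm he)⟩
  | @mono X U V o h hUV ih =>
    refine ⟨fun ho => ?_, fun p q ho => ?_⟩
    · obtain ⟨k, h₁, h₂, h₃⟩ := ih.1 ho
      exact ⟨k, h₁, h₂, fun x hx m a b hm he => h₃ x hx m a b (fun h => hm (hUV h)) he⟩
    · obtain ⟨k, h₁, h₂, h₃, h₄, h₅, h₆⟩ := ih.2 p q ho
      exact ⟨k, h₁, h₂, h₃, h₄, h₅, fun x hx m a b hm he => h₆ x hx m a b (fun h => hm (hUV h)) he⟩

/-- The walk along a list. -/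
theorem exists_walk {V : Type*} {G : SimpleGraph V} (a : V) (l : List V)
    (h : (a :: l).IsChain G.Adj) :
    ∃ (b : V) (p : G.Walk a b), p.support = a :: l ∧ (a :: l).getLast? = some b := by
  induction l generalizing a with
  | nil => exact ⟨a, .nil, rfl, rfl⟩
  | cons c l ih =>
    obtain ⟨h₁, h₂⟩ := List.isChain_cons_cons.1 h
    obtain ⟨b, p, hp, hb⟩ := ih c h₂
    exact ⟨b, .cons h₁ p, by simp [hp], by simpa [List.getLast?_cons_cons] using hb⟩

/-- A cyclic list of all vertices is a Hamilton cycle. -/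
theorem IsCyc.exists_isHamiltonianCycle {V : Type*} [DecidableEq V] {G : SimpleGraph V}
    {l : List V} (h : IsCyc G.Adj l) (hl : 3 ≤ l.length) (hall : ∀ v, v ∈ l) :
    ∃ (v : V) (p : G.Walk v v), p.IsHamiltonianCycle := by
  obtain ⟨a, b, ha, hb, hab⟩ := h.closed
  obtain ⟨t, rfl⟩ := List.head?_eq_some_iff.1 ha
  obtain ⟨b', p, hp, hb'⟩ := exists_walk a t h.isChain
  rw [hb] at hb'
  obtain rfl : b = b' := by simpa using hb'
  have hpath : p.IsPath := SimpleGraph.Walk.IsPath.mk' (by rw [hp]; exact h.nodup)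
  have hlen : p.length + 1 = (a :: t).length := by rw [← hp, SimpleGraph.Walk.length_support]
  refine ⟨b, .cons hab p, ⟨?_, ?_⟩⟩
  · rw [SimpleGraph.Walk.cons_isCycle_iff]
    refine ⟨hpath, fun he => ?_⟩
    rw [Sym2.eq_swap] at he
    have := hpath.length_eq_one_of_mem_edges he
    omega
  · have := hpath.isHamiltonian_of_mem (fun w => by rw [hp]; exact hall w)
    simpa [SimpleGraph.Walk.IsHamiltonian] using this

/-- The endpoint of the reduction: if all cycles are joined, the odd graph is Hamiltonian. -/
theorem Hooked.exists_isHamiltonianCycle {k : ℕ} (hk : 1 ≤ k) {U : Set (Shape × Label)}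
    (h : Hooked {x | x.numNodes = k} U none) :
    ∃ (v : Vertex k) (p : (oddGraph k).Walk v v), p.IsHamiltonianCycle := by
  obtain ⟨l, h₁, h₂, -⟩ := h.exists_list.1 rfl
  obtain ⟨m, rfl⟩ : ∃ m : List (Vertex k), m.map toWord = l := by
    have : ∀ w ∈ l, ∃ s : Vertex k, toWord s = w := by
      intro w hw
      obtain ⟨x, rfl, hx⟩ := (h₂ w).1 hw
      exact exists_toWord_eq hx
    clear h₁ h₂
    induction l with
    | nil => exact ⟨[], rfl⟩
    | cons w l ih =>
      obtain ⟨m, rfl⟩ := ih fun w hw => this w (List.mem_cons_of_mem _ hw)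
      obtain ⟨s, rfl⟩ := this w List.mem_cons_self
      exact ⟨s :: m, rfl⟩
  have hall : ∀ s, s ∈ m := by
    intro s
    have hs : toWord s ∈ m.map toWord := by
      obtain ⟨x, hx, hx'⟩ := mem_allStates.1 (toWord_mem_allStates s)
      exact (h₂ _).2 ⟨x, hx, hx'⟩
    obtain ⟨t, ht, hts⟩ := List.mem_map.1 hs
    rwa [← toWord_injective k hts]
  refine IsCyc.exists_isHamiltonianCycle (l := m) ⟨h₁.nodup.of_map _, ?_, ?_⟩ ?_ hall
  · exact ((List.isChain_map _).1 h₁.isChain).imp fun _ _ h => adj_of_near hk h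
  · obtain ⟨a, b, ha, hb, hab⟩ := h₁.closed
    simp only [List.head?_map, List.getLast?_map, Option.map_eq_some_iff] at ha hb
    obtain ⟨a, ha, rfl⟩ := ha
    obtain ⟨b, hb, rfl⟩ := hb
    exact ⟨a, b, ha, hb, adj_of_near hk hab⟩
  · have h₃ : m.toFinset = Finset.univ := Finset.eq_univ_iff_forall.2 fun s => by simp [hall]
    have h₄ := List.toFinset_card_le m
    rw [h₃, Finset.card_univ, card_vertex] at h₄
    have h₅ : 1 ≤ catalan k := by
      have := succ_mul_catalan_eq_centralBinom k
      have := Nat.centralBinom_pos k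
      by_contra hc
      simp_all
    nlinarith

/-! ### Hyperedges -/

/-- An edge of `states x` without regard to its direction. -/
def Joins (e : Shape × Label) (p q : Word) : Prop := IsEdge e.1 e.2 p q ∨ IsEdge e.1 e.2 q p

/-- Three edges that alternate with three further edges in a `6`-cycle. -/
def Triple (e₁ e₂ e₃ : Shape × Label) : Prop :=
  ∃ p₁ q₁ p₂ q₂ p₃ q₃, Joins e₁ p₁ q₁ ∧ Joins e₂ p₂ q₂ ∧ Joins e₃ p₃ q₃ ∧
    Flip q₁ p₂ ∧ Flip q₂ p₃ ∧ Flip q₃ p₁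

/-- Four edges that alternate with four further edges in an `8`-cycle. -/
def Quad (e₁ e₂ e₃ e₄ : Shape × Label) : Prop :=
  ∃ p₁ q₁ p₂ q₂ p₃ q₃ p₄ q₄, Joins e₁ p₁ q₁ ∧ Joins e₂ p₂ q₂ ∧ Joins e₃ p₃ q₃ ∧
    Joins e₄ p₄ q₄ ∧ Flip q₁ p₂ ∧ Flip q₂ p₃ ∧ Flip q₃ p₄ ∧ Flip q₄ p₁

/-- A joined family `X` together with an unused edge `e` of one of its trees. -/
structure Ready (X : Set Shape) (U : Set (Shape × Label)) (e : Shape × Label) : Prop where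
  hooked : Hooked X U none
  mem : e.1 ∈ X
  unused : e ∉ U

theorem Ready.cut {X : Set Shape} {U : Set (Shape × Label)} {e : Shape × Label} {p q : Word}
    (h : Ready X U e) (he : Joins e p q) : Hooked X (insert e U) (some (p, q)) := by
  rcases he with he | he
  · exact Hooked.cut h.hooked h.mem h.unused he
  · exact (Hooked.cut h.hooked h.mem h.unused he).swap

variable {X₁ X₂ X₃ X₄ : Set Shape} {U₁ U₂ U₃ U₄ : Set (Shape × Label)}
  {e₁ e₂ e₃ e₄ : Shape × Label}

theorem Triple.join (h : Triple e₁ e₂ e₃) (h₁ : Ready X₁ U₁ e₁) (h₂ : Ready X₂ U₂ e₂)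
    (h₃ : Ready X₃ U₃ e₃) (d₁₂ : Disjoint X₁ X₂) (d₁₃ : Disjoint X₁ X₃) (d₂₃ : Disjoint X₂ X₃) :
    Hooked (X₁ ∪ X₂ ∪ X₃) (insert e₁ U₁ ∪ insert e₂ U₂ ∪ insert e₃ U₃) none := by
  obtain ⟨p₁, q₁, p₂, q₂, p₃, q₃, j₁, j₂, j₃, f₁, f₂, f₃⟩ := h
  exact (((h₁.cut j₁).glue (h₂.cut j₂) f₁ d₁₂).glue (h₃.cut j₃) f₂
    (Set.disjoint_union_left.2 ⟨d₁₃, d₂₃⟩)).close f₃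

theorem Quad.join (h : Quad e₁ e₂ e₃ e₄) (h₁ : Ready X₁ U₁ e₁) (h₂ : Ready X₂ U₂ e₂)
    (h₃ : Ready X₃ U₃ e₃) (h₄ : Ready X₄ U₄ e₄) (d₁₂ : Disjoint X₁ X₂) (d₁₃ : Disjoint X₁ X₃)
    (d₂₃ : Disjoint X₂ X₃) (d₁₄ : Disjoint X₁ X₄) (d₂₄ : Disjoint X₂ X₄) (d₃₄ : Disjoint X₃ X₄) :
    Hooked (X₁ ∪ X₂ ∪ X₃ ∪ X₄)
      (insert e₁ U₁ ∪ insert e₂ U₂ ∪ insert e₃ U₃ ∪ insert e₄ U₄) none := by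
  obtain ⟨p₁, q₁, p₂, q₂, p₃, q₃, p₄, q₄, j₁, j₂, j₃, j₄, f₁, f₂, f₃, f₄⟩ := h
  exact ((((h₁.cut j₁).glue (h₂.cut j₂) f₁ d₁₂).glue (h₃.cut j₃) f₂
    (Set.disjoint_union_left.2 ⟨d₁₃, d₂₃⟩)).glue (h₄.cut j₄) f₃
    (Set.disjoint_union_left.2 ⟨Set.disjoint_union_left.2 ⟨d₁₄, d₂₄⟩, d₃₄⟩)).close f₄

/-! ### Lifting to larger trees -/

/-- The trees with a root, whose two subtrees satisfy `P`. -/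
def nodes (P : Shape → Shape → Prop) : Set Shape := {t | ∃ u v, t = u △ v ∧ P u v}

@[simp] theorem mem_nodes {P : Shape → Shape → Prop} {u v : Shape} : u △ v ∈ nodes P ↔ P u v :=
  ⟨by rintro ⟨u', v', h, hP⟩; cases h; exact hP, fun h => ⟨u, v, rfl, h⟩⟩

theorem nodes_union (P Q : Shape → Shape → Prop) :
    nodes P ∪ nodes Q = nodes fun u v => P u v ∨ Q u v := by
  ext t
  constructor
  · rintro (⟨u, v, rfl, h⟩ | ⟨u, v, rfl, h⟩) <;> simp [h]
  · rintro ⟨u, v, rfl, h⟩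
    simpa using h

theorem nodes_congr {P Q : Shape → Shape → Prop} (h : ∀ u v, P u v ↔ Q u v) :
    nodes P = nodes Q := by
  have : P = Q := by ext u v; exact h u v
  rw [this]

theorem disjoint_nodes {P Q : Shape → Shape → Prop} (h : ∀ u v, P u v → ¬Q u v) :
    Disjoint (nodes P) (nodes Q) := by
  rw [Set.disjoint_left]
  rintro t ⟨u, v, rfl, hP⟩ hQ
  exact h u v hP (mem_nodes.1 hQ)

/-- The used edges after lifting: those of the right subtrees, and those of the left subtrees. -/
def gridUsed (U V : Set (Shape × Label)) : Set (Shape × Label) :=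
  {e | (∃ u v l, (v, l) ∈ V ∧ e = (u △ v, .right l)) ∨
    (∃ u v l, (u, l) ∈ U ∧ e = (u △ v, .left l))}

@[simp] theorem right_mem_gridUsed {U V : Set (Shape × Label)} {u v : Shape} {l : Label} :
    (u △ v, Label.right l) ∈ gridUsed U V ↔ (v, l) ∈ V := by
  constructor
  · rintro (⟨u', v', l', h, he⟩ | ⟨u', v', l', h, he⟩)
    · cases he; exact h
    · cases he
  · exact fun h => .inl ⟨_, _, _, h, rfl⟩

@[simp] theorem left_mem_gridUsed {U V : Set (Shape × Label)} {u v : Shape} {l : Label} :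
    (u △ v, Label.left l) ∈ gridUsed U V ↔ (u, l) ∈ U := by
  constructor
  · rintro (⟨u', v', l', h, he⟩ | ⟨u', v', l', h, he⟩)
    · cases he
    · cases he; exact h
  · exact fun h => .inr ⟨_, _, _, h, rfl⟩

@[simp] theorem opening_notMem_gridUsed {U V : Set (Shape × Label)} {x : Shape} :
    (x, Label.opening) ∉ gridUsed U V := by
  rintro (⟨u', v', l', h, he⟩ | ⟨u', v', l', h, he⟩) <;> cases he

@[simp] theorem closing_notMem_gridUsed {U V : Set (Shape × Label)} {x : Shape} :
    (x, Label.closing) ∉ gridUsed U V := by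
  rintro (⟨u', v', l', h, he⟩ | ⟨u', v', l', h, he⟩) <;> cases he

theorem gridUsed_union (U U' V V' : Set (Shape × Label)) :
    gridUsed U V ∪ gridUsed U' V' ⊆ gridUsed (U ∪ U') (V ∪ V') := by
  rintro e ((⟨u, v, l, h, rfl⟩ | ⟨u, v, l, h, rfl⟩) | (⟨u, v, l, h, rfl⟩ | ⟨u, v, l, h, rfl⟩)) <;>
    simp [h]

theorem gridUsed_mono {U U' V V' : Set (Shape × Label)} (hU : U ⊆ U') (hV : V ⊆ V') :
    gridUsed U V ⊆ gridUsed U' V' := by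
  rintro e (⟨u, v, l, h, rfl⟩ | ⟨u, v, l, h, rfl⟩)
  · simpa using hV h
  · simpa using hU h

theorem Hooked.row {X : Set Shape} {U : Set (Shape × Label)} {o : Option (Word × Word)}
    (u : Shape) (h : Hooked X U o) :
    Hooked (nodes fun u' v => u' = u ∧ v ∈ X) (gridUsed ∅ U)
      (o.map (Prod.map (liftR u) (liftR u))) := by
  induction h with
  | single x =>
    have : (nodes fun u' v => u' = u ∧ v ∈ ({x} : Set Shape)) = {u △ x} := by
      ext t
      constructor
      · rintro ⟨u', v, rfl, rfl, rfl⟩; rfl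
      · rintro rfl; simp
    rw [this]
    exact (Hooked.single _).mono (Set.empty_subset _)
  | @cut X U x l p q h hx hl he ih =>
    refine (Hooked.cut ih (x := u △ x) (l := .right l) (by simpa using hx) (by simpa using hl)
      (.right u he)).mono ?_
    refine Set.insert_subset (by simp) (gridUsed_mono subset_rfl (Set.subset_insert _ _))
  | swap _ ih => exact ih.swap
  | @glue X U p q Y V r s h h' hqr hXY ih ih' =>
    have := (ih.glue ih' (hqr.liftR u) (disjoint_nodes fun u' v h₁ h₂ =>
      Set.disjoint_left.1 hXY h₁.2 h₂.2)).mono (gridUsed_union _ _ _ _)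
    rw [nodes_union] at this
    convert this using 2
    · ext u' v
      simp only [Set.mem_union]
      tauto
    · simp
    · rfl
  | close _ hpq ih => exact ih.close (hpq.liftR u)
  | mono _ hUV ih => exact ih.mono (gridUsed_mono subset_rfl hUV)

/-- If the trees in `X` and the trees in `Y` can be joined, then so can the trees with left
subtree in `X` and right subtree in `Y`: join each row, and then one column. -/
theorem Hooked.grid {X Y : Set Shape} {U V : Set (Shape × Label)} {o : Option (Word × Word)}
    (h : Hooked X U o) (h' : Hooked Y V none) {v₀ : Shape} (hv₀ : v₀ ∈ Y) :
    Hooked (nodes fun u v => u ∈ X ∧ v ∈ Y) (gridUsed U V)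
      (o.map (Prod.map (liftL v₀) (liftL v₀))) := by
  induction h with
  | single x => exact h'.row x
  | @cut X U x l p q h hx hl he ih =>
    refine (Hooked.cut ih (x := x △ v₀) (l := .left l) (by simpa using ⟨hx, hv₀⟩) (by simpa using hl)
      (.left v₀ he)).mono ?_
    exact Set.insert_subset (by simp) (gridUsed_mono (Set.subset_insert _ _) subset_rfl)
  | swap _ ih => exact ih.swap
  | @glue X U p q X' U' r s h h' hqr hXY ih ih' =>
    have := (ih.glue ih' (hqr.liftL v₀) (disjoint_nodes fun u' v h₁ h₂ =>
      Set.disjoint_left.1 hXY h₁.1 h₂.1)).mono (gridUsed_union _ _ _ _)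
    rw [nodes_union] at this
    convert this using 2
    · ext u' v
      simp only [Set.mem_union]
      tauto
    · simp
    · rfl
  | close _ hpq ih => exact ih.close (hpq.liftL v₀)
  | mono _ hUV ih => exact ih.mono (gridUsed_mono hUV subset_rfl)

open Label BinaryTree

/-! ### The hyperedges used for joining -/

/-- Right combs: the tree with `n` nodes all of whose left subtrees are empty. -/
def comb : ℕ → Shape
  | 0 => nil
  | n + 1 => nil △ comb n

/-- The tree with two nodes that is not a comb. -/
def hook : Shape := (nil △ nil) △ nil

@[simp] theorem comb_zero : comb 0 = nil := rfl

theorem comb_succ (n : ℕ) : comb (n + 1) = nil △ comb n := rfl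

@[simp] theorem numNodes_comb (n : ℕ) : (comb n).numNodes = n := by
  induction n with
  | zero => rfl
  | succ n ih => simp [comb_succ, ih]

/-- The `n`-fold iterate of `Label.right`, applied to `Label.opening`: in the tree `comb (n + 1)` it
names the first edge that belongs to the last node. -/
def spine : ℕ → Label
  | 0 => opening
  | n + 1 => right (spine n)

@[simp] theorem numNodes_hook : hook.numNodes = 2 := rfl

theorem numNodes_nil : (nil : Shape).numNodes = 0 := rfl

/-- The word `0101⋯01` with `n` repetitions. -/
def alt : ℕ → Word
  | 0 => []
  | n + 1 => false :: true :: alt n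

theorem alt_append (n : ℕ) (w : Word) :
    alt n ++ false :: true :: w = false :: true :: (alt n ++ w) := by
  induction n with
  | zero => rfl
  | succ n ih => simp [alt, ih]

theorem reverse_dyck_comb (n : ℕ) : (dyck (comb n)).reverse = alt n := by
  induction n with
  | zero => rfl
  | succ n ih =>
    have := alt_append n []
    simp only [List.append_nil] at this
    simp [comb_succ, ih, alt, this]

theorem rc_alt (n : ℕ) : rc (alt n) = alt n := by
  induction n with
  | zero => rfl
  | succ n ih =>
    have := alt_append n []
    simp only [List.append_nil] at this
    simp [alt, ih, this]

theorem isEdge_spine (n : ℕ) :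
    IsEdge (comb (n + 1)) (spine n) (alt n ++ [true, false]) (alt n ++ [true, true]) := by
  induction n with
  | zero => exact IsEdge.opening nil nil
  | succ n ih => exact IsEdge.right nil ih

/-- The comb with `m` nodes, extended at the top by two nodes with empty right subtrees; in
particular `peak 0 = hook`. -/
def peak (m : ℕ) : Shape := (comb m △ nil) △ nil

@[simp] theorem numNodes_peak (m : ℕ) : (peak m).numNodes = m + 2 := by simp [peak]

theorem reverse_dyck_peak (m : ℕ) :
    (dyck (peak m)).reverse = false :: false :: (alt m ++ [true, true]) := by
  simp [peak, reverse_dyck_comb]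

theorem joins_hub_left (m : ℕ) (d : Shape) : Joins (nil △ (comb m △ (nil △ d)), right (right opening))
    (false :: true :: false :: (alt m ++ true :: true :: false :: dyck d))
    (false :: true :: false :: (alt m ++ true :: true :: true :: dyck d)) := by
  left
  have := IsEdge.right nil (IsEdge.right (comb m) (IsEdge.opening nil d))
  simpa [liftR, liftL, reverse_dyck_comb] using this

theorem joins_hub_middle (m : ℕ) (d : Shape) : Joins (comb (m + 1) △ (nil △ d), left (spine m))
    (true :: true :: false :: (alt m ++ true :: true :: false :: dyck d))
    (true :: false :: false :: (alt m ++ true :: true :: false :: dyck d)) := by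
  left
  have := IsEdge.left (nil △ d) (isEdge_spine m)
  simpa [liftL, rc_alt] using this

theorem joins_hub_right (m : ℕ) (d : Shape) : Joins (peak m △ d, closing)
    (true :: false :: false :: (alt m ++ true :: true :: true :: dyck d))
    (false :: false :: false :: (alt m ++ true :: true :: true :: dyck d)) := by
  left
  have := IsEdge.closing (peak m) d
  simpa [liftL, liftR, reverse_dyck_peak] using this

/-- Joins a tree with empty left subtree, a tree with `m + 1` nodes on the left, and one with `m + 2`
nodes on the left. -/
theorem triple_hub (m : ℕ) (d : Shape) : Triple
    (nil △ (comb m △ (nil △ d)), right (right opening))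
    (comb (m + 1) △ (nil △ d), left (spine m))
    (peak m △ d, closing) := by
  refine ⟨_, _, _, _, _, _, (joins_hub_left m d).symm, joins_hub_middle m d,
    joins_hub_right m d, ?_, ?_, ?_⟩ <;>
  repeat first | exact Flip.head _ _ _ rfl | apply Flip.cons | apply Flip.append_left

/-- Joins a tree with empty left subtree, a tree with `m + 1` nodes on the left, one with empty right
subtree, and one with a single node on the right. -/
theorem quad_hub (m : ℕ) : Quad
    (nil △ (comb m △ (nil △ comb 1)), right (right opening))
    (comb (m + 1) △ (nil △ comb 1), left (spine m))
    ((nil △ peak m) △ nil, closing)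
    (peak m △ comb 1, right opening) := by
  have h₃ : Joins ((nil △ peak m) △ nil, closing)
      (true :: false :: false :: (alt m ++ true :: true :: false :: [true, true]))
      (false :: false :: false :: (alt m ++ true :: true :: false :: [true, true])) := by
    left
    have := IsEdge.closing (nil △ peak m) nil
    simpa [liftL, liftR, reverse_dyck_peak] using this
  have h₄ : Joins (peak m △ comb 1, right opening)
      (false :: false :: false :: (alt m ++ true :: true :: true :: [true, true]))
      (false :: false :: false :: (alt m ++ true :: true :: true :: [true, false])) := by
    right
    have := IsEdge.right (peak m) (IsEdge.opening nil nil)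
    simpa [liftL, liftR, reverse_dyck_peak, comb] using this
  refine ⟨_, _, _, _, _, _, _, _, (joins_hub_left m (comb 1)).symm,
    joins_hub_middle m (comb 1), h₃, h₄, ?_, ?_, ?_, ?_⟩ <;>
  repeat first | exact Flip.head _ _ _ rfl | apply Flip.cons | apply Flip.append_left

/-- Joins a tree with empty left subtree to the trees with left subtrees `comb 2`, `hook` and
`comb 1`. -/
theorem quad_start (d : Shape) : Quad
    (nil △ (comb 1 △ d), opening) (comb 2 △ d, opening) (hook △ d, left closing)
    (comb 1 △ (nil △ d), left closing) := by
  refine ⟨_, _, _, _, _, _, _, _, .inl (.opening _ _), .inl (.opening _ _),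
    .inl (.left _ (.closing _ _)), .inl (.left _ (.closing _ _)), ?_, ?_, ?_, ?_⟩ <;>
  simp [liftL, liftR, comb] <;>
  repeat first | exact Flip.head _ _ _ rfl | apply Flip.cons

theorem triple_start (d : Shape) : Triple
    (nil △ (comb 1 △ d), opening) (comb 2 △ d, opening) (hook △ d, left (left closing)) := by
  refine ⟨_, _, _, _, _, _, .inl (.opening _ _), .inl (.opening _ _),
    .inr (.left _ (.left _ (.closing _ _))), ?_, ?_, ?_⟩ <;>
  simp [liftL, liftR, comb] <;>
  repeat first | exact Flip.head _ _ _ rfl | apply Flip.cons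

theorem triple_comb_three : Triple
    (comb 3, closing) (hook △ nil, opening) (nil △ hook, right (left closing)) := by
  refine ⟨_, _, _, _, _, _, .inr (.closing _ _), .inl (.opening _ _),
    .inl (.right _ (.left _ (.closing _ _))), ?_, ?_, ?_⟩ <;>
  simp [liftL, liftR, comb, hook] <;>
  repeat first | exact Flip.head _ _ _ rfl | apply Flip.cons

theorem triple_comb_one_comb_one : Triple
    (comb 1 △ comb 1, right closing) (comb 2 △ nil, closing) (hook △ nil, left (left opening)) := by
  refine ⟨_, _, _, _, _, _, .inr (.right _ (.closing _ _)), .inr (.closing _ _),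
    .inl (.left _ (.left _ (.opening _ _))), ?_, ?_, ?_⟩ <;>
  simp [liftL, liftR, comb] <;>
  repeat first | exact Flip.head _ _ _ rfl | apply Flip.cons

theorem triple_nil_hook_nil : Triple (nil △ (hook △ nil), opening)
    ((comb 1 △ comb 1) △ nil, opening) ((comb 2 △ nil) △ nil, left (left closing)) := by
  refine ⟨_, _, _, _, _, _, .inl (.opening _ _), .inl (.opening _ _),
    .inr (.left _ (.left _ (.closing _ _))), ?_, ?_, ?_⟩ <;>
  simp [liftL, liftR, comb, hook] <;>
  repeat first | exact Flip.head _ _ _ rfl | apply Flip.cons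

theorem triple_comb_one_hook : Triple (comb 1 △ hook, opening)
    (comb 3 △ nil, opening) ((comb 1 △ comb 1) △ nil, left (left closing)) := by
  refine ⟨_, _, _, _, _, _, .inl (.opening _ _), .inl (.opening _ _),
    .inr (.left _ (.left _ (.closing _ _))), ?_, ?_, ?_⟩ <;>
  simp [liftL, liftR, comb, hook] <;>
  repeat first | exact Flip.head _ _ _ rfl | apply Flip.cons

/-! ### Reserved edges -/

/-- The right subtrees `d` that occur in the hyperedges of the recursion. -/
def Tail (d : Shape) : Prop := (∃ n, d = comb n) ∨ d = hook

/-- Edges that are kept free in every tree, because the hyperedges of the recursion use their lifts: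
the first two kinds in right subtrees, the third one in left subtrees.  The lift of an edge of the
second kind to a tree with empty left subtree is a `hub`. -/
def Reserved (e : Shape × Label) : Prop :=
  (∃ d, Tail d ∧ e = (nil △ d, opening)) ∨
  (∃ n d, Tail d ∧ e = (comb n △ (nil △ d), right opening)) ∨
  ∃ n, e = (comb (n + 1), spine n)

/-- No edge in `U` is reserved. -/
def Unreserved (U : Set (Shape × Label)) : Prop := ∀ e ∈ U, ¬Reserved e

theorem unreserved_empty : Unreserved ∅ := fun _ h => h.elim

theorem Unreserved.union {U V : Set (Shape × Label)} (hU : Unreserved U) (hV : Unreserved V) :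
    Unreserved (U ∪ V) := fun e he => he.elim (hU e) (hV e)

theorem Unreserved.insert {U : Set (Shape × Label)} {e : Shape × Label} (hU : Unreserved U)
    (he : ¬Reserved e) : Unreserved (insert e U) := by
  rintro f (rfl | hf)
  · exact he
  · exact hU f hf

/-- The edges of trees `nil △ (comb n △ (nil △ d))` through which the class of trees with empty
left subtree is attached to the other classes. -/
def hub (n : ℕ) (d : Shape) : Shape × Label :=
  (nil △ (comb n △ (nil △ d)), right (right opening))

/-- `U` contains no reserved edge and no hub with index at least `m`. -/
def Free (m : ℕ) (U : Set (Shape × Label)) : Prop :=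
  Unreserved U ∧ ∀ n d, m ≤ n → Tail d → hub n d ∉ U

theorem Free.mono {m m' : ℕ} {U : Set (Shape × Label)} (h : Free m U) (hm : m ≤ m') : Free m' U :=
  ⟨h.1, fun n d hn hd => h.2 n d (hm.trans hn) hd⟩

theorem Free.union {m : ℕ} {U V : Set (Shape × Label)} (hU : Free m U) (hV : Free m V) :
    Free m (U ∪ V) :=
  ⟨hU.1.union hV.1, fun n d hn hd h => h.elim (hU.2 n d hn hd) (hV.2 n d hn hd)⟩

theorem Free.insert {m : ℕ} {U : Set (Shape × Label)} {e : Shape × Label} (hU : Free m U)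
    (he : ¬Reserved e) (he' : ∀ n d, m ≤ n → hub n d ≠ e) : Free m (insert e U) := by
  refine ⟨hU.1.insert he, fun n d hn hd h => ?_⟩
  rcases h with h | h
  · exact he' n d hn h
  · exact hU.2 n d hn hd h

theorem tail_comb (n : ℕ) : Tail (comb n) := .inl ⟨n, rfl⟩

theorem tail_hook : Tail hook := .inr rfl

theorem comb_eq_node {n : ℕ} {u v : Shape} (h : comb n = u △ v) :
    u = nil ∧ ∃ k, n = k + 1 ∧ v = comb k := by
  cases n with
  | zero => cases h
  | succ n => rw [comb_succ] at h; cases h; exact ⟨rfl, n, rfl, rfl⟩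

theorem comb_injective : Function.Injective comb := fun m n h => by
  simpa using congrArg numNodes h

theorem not_reserved_closing (x : Shape) : ¬Reserved (x, closing) := by
  rintro (⟨d, -, h⟩ | ⟨n, d, -, h⟩ | ⟨_ | n, h⟩) <;> simp [spine] at h

theorem not_reserved_left (x : Shape) (l : Label) : ¬Reserved (x, left l) := by
  rintro (⟨d, -, h⟩ | ⟨n, d, -, h⟩ | ⟨_ | n, h⟩) <;> simp [spine] at h

theorem not_reserved_right_left (x : Shape) (l : Label) : ¬Reserved (x, right (left l)) := by
  rintro (⟨d, -, h⟩ | ⟨n, d, -, h⟩ | ⟨_ | _ | n, h⟩) <;> simp [spine] at h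

theorem not_reserved_right_closing (x : Shape) : ¬Reserved (x, right closing) := by
  rintro (⟨d, -, h⟩ | ⟨n, d, -, h⟩ | ⟨_ | _ | n, h⟩) <;> simp [spine] at h

theorem not_reserved_opening {u v : Shape} (h : u = nil → ¬Tail v) : ¬Reserved (u △ v, opening) := by
  rintro (⟨d, hd, he⟩ | ⟨n, d, -, he⟩ | ⟨_ | n, he⟩)
  · cases he
    exact h rfl hd
  · simp at he
  · cases he
    exact h rfl (tail_comb 0)
  · simp [spine] at he

theorem not_reserved_right_opening {u v : Shape} (h : ∀ n, u ≠ comb n) :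
    ¬Reserved (u △ v, right opening) := by
  rintro (⟨d, hd, he⟩ | ⟨n, d, -, he⟩ | ⟨_ | _ | n, he⟩)
  · simp at he
  · cases he
    exact h n rfl
  · simp [spine] at he
  · cases he
    exact h 0 rfl
  · simp [spine] at he

/-- For `n = 0` and `d = nil` the hub is the reserved edge of `comb 3`. -/
theorem not_reserved_hub {n : ℕ} {d : Shape} (h : n ≠ 0 ∨ d ≠ nil) : ¬Reserved (hub n d) := by
  rintro (⟨d, hd, he⟩ | ⟨n, d, -, he⟩ | ⟨_ | _ | _ | k, he⟩) <;> simp [hub, spine] at he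
  have h₁ := (comb_eq_node he.symm).2
  obtain ⟨k, hk, h₁⟩ := h₁
  obtain ⟨h₂, k', hk', h₃⟩ := comb_eq_node h₁.symm
  obtain ⟨h₄, k'', hk'', h₅⟩ := comb_eq_node h₃.symm
  have : k'' = 0 := by omega
  subst this
  rcases h with h | h
  · exact h (comb_injective (a₂ := 0) h₂)
  · exact h h₅

theorem not_tail_node {u v : Shape} (h₁ : u ≠ nil) (h₂ : u ≠ comb 1 ∨ v ≠ nil) :
    ¬Tail (u △ v) := by
  rintro (⟨n, h⟩ | h)
  · exact h₁ (comb_eq_node h.symm).1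
  · cases h
    simp [comb] at h₂

/-- Lifting to larger trees preserves the invariant: a lifted edge of a left subtree is never
reserved, and a reserved edge or hub that is lifted from a right subtree is reserved there. -/
theorem Unreserved.free_gridUsed {U V : Set (Shape × Label)} (hV : Unreserved V) : Free 0 (gridUsed U V) := by
  refine ⟨?_, fun n d _ hd h => ?_⟩
  · rintro e (⟨u, v, l, h, rfl⟩ | ⟨u, v, l, h, rfl⟩)
    · rintro (⟨d, -, he⟩ | ⟨n, d, hd, he⟩ | ⟨_ | n, he⟩)
      · simp at he
      · cases he
        exact hV _ h (.inl ⟨d, hd, rfl⟩)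
      · simp [spine] at he
      · simp only [Prod.mk.injEq, spine, right.injEq] at he
        obtain ⟨-, k, hk, rfl⟩ := comb_eq_node he.1.symm
        obtain rfl : n + 1 = k := by omega
        obtain ⟨-, rfl⟩ := he
        exact hV _ h (.inr (.inr ⟨n, rfl⟩))
    · exact not_reserved_left _ _
  · rw [hub, right_mem_gridUsed] at h
    exact hV _ h (.inr (.inl ⟨n, d, hd, rfl⟩))

/-! ### Blocks and stages -/

/-- The trees with `k` nodes. -/
def ofSize (k : ℕ) : Set Shape := {x | x.numNodes = k}

/-- The trees with `k` nodes can be joined without using reserved edges.  This is the induction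
hypothesis of the recursion. -/
def Joinable (k : ℕ) : Prop := ∃ U, Hooked (ofSize k) U none ∧ Unreserved U

/-- The trees described by `P` have been joined inside the subtrees, using the edges in `U` of the
left subtrees and the edges in `V` of the right subtrees. -/
structure Block (P : Shape → Shape → Prop) (U V : Set (Shape × Label)) : Prop where
  hooked : Hooked (nodes P) (gridUsed U V) none
  left : Unreserved U
  right : Unreserved V

theorem Block.free {P : Shape → Shape → Prop} {U V : Set (Shape × Label)} (h : Block P U V) :
    Free 0 (gridUsed U V) := h.right.free_gridUsed

theorem block_of_hooked {X Y : Set Shape} {U V : Set (Shape × Label)} {P : Shape → Shape → Prop}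
    (hX : Hooked X U none) (hU : Unreserved U) (hY : Hooked Y V none) (hV : Unreserved V)
    (hne : Y.Nonempty) (hP : ∀ u v, P u v ↔ u ∈ X ∧ v ∈ Y) : Block P U V := by
  obtain ⟨v₀, hv₀⟩ := hne
  refine ⟨?_, hU, hV⟩
  rw [nodes_congr hP]
  exact hX.grid hY hv₀

theorem ofSize_nonempty (k : ℕ) : (ofSize k).Nonempty := ⟨comb k, numNodes_comb k⟩

theorem ofSize_zero : ofSize 0 = {nil} := by
  ext x
  cases x <;> simp [ofSize]

theorem numNodes_eq_zero {x : Shape} : x.numNodes = 0 ↔ x = nil := by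
  cases x <;> simp

theorem numNodes_eq_one {x : Shape} : x.numNodes = 1 ↔ x = comb 1 := by
  cases x with
  | nil => simp [comb]
  | node _ u v => simp [comb, numNodes_eq_zero]

theorem numNodes_eq_two {x : Shape} : x.numNodes = 2 ↔ x = hook ∨ x = comb 2 := by
  cases x with
  | nil => simp [comb, hook]
  | node _ u v =>
    have : (u.numNodes + v.numNodes + 1 = 2) ↔
      (u.numNodes = 1 ∧ v.numNodes = 0 ∨ u.numNodes = 0 ∧ v.numNodes = 1) := by omega
    simp only [numNodes, this, numNodes_eq_zero, numNodes_eq_one]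
    simp [comb, hook]

theorem hook_ne_comb (n : ℕ) : hook ≠ comb n := by
  intro h
  have := (comb_eq_node h.symm).1
  cases this

theorem ofSize_one : ofSize 1 = {comb 1} := by
  ext x
  exact numNodes_eq_one

theorem ofSize_succ (n : ℕ) : ofSize (n + 1) = nodes fun u v => u.numNodes + v.numNodes = n := by
  ext x
  cases x with
  | nil =>
    constructor
    · intro h; simp [ofSize] at h
    · rintro ⟨u, v, h, -⟩; cases h
  | node _ u v =>
    change u △ v ∈ _ ↔ u △ v ∈ _
    simp [ofSize]

theorem hooked_zero : Hooked (ofSize 0) ∅ none := ofSize_zero ▸ .single _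

theorem hooked_one : Hooked (ofSize 1) ∅ none := ofSize_one ▸ .single _

theorem joinable_zero : Joinable 0 := ⟨∅, hooked_zero, unreserved_empty⟩

theorem joinable_one : Joinable 1 := ⟨∅, hooked_one, unreserved_empty⟩

theorem block_grid {i j : ℕ} (hi : Joinable i) (hj : Joinable j) :
    ∃ U V, Block (fun u v => u.numNodes = i ∧ v.numNodes = j) U V := by
  obtain ⟨U, hU, hU'⟩ := hi
  obtain ⟨V, hV, hV'⟩ := hj
  exact ⟨U, V, block_of_hooked hU hU' hV hV' (ofSize_nonempty j) fun _ _ => .rfl⟩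

theorem block_column {i : ℕ} (hi : Joinable i) (x : Shape) :
    ∃ U, Block (fun u v => u.numNodes = i ∧ v = x) U ∅ := by
  obtain ⟨U, hU, hU'⟩ := hi
  exact ⟨U, block_of_hooked hU hU' (.single x) unreserved_empty (Set.singleton_nonempty x)
    fun _ _ => .rfl⟩

theorem block_row {j : ℕ} (x : Shape) (hj : Joinable j) :
    ∃ V, Block (fun u v => u = x ∧ v.numNodes = j) ∅ V := by
  obtain ⟨V, hV, hV'⟩ := hj
  exact ⟨V, block_of_hooked (.single x) unreserved_empty hV hV' (ofSize_nonempty j)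
    fun _ _ => .rfl⟩

theorem block_single (x y : Shape) : Block (fun u v => u = x ∧ v = y) ∅ ∅ :=
  block_of_hooked (.single x) unreserved_empty (.single y) unreserved_empty
    (Set.singleton_nonempty y) fun _ _ => .rfl

/-- The trees described by `P` have been joined, and the hubs from index `m` on are unused. -/
def Stage (m : ℕ) (P : Shape → Shape → Prop) : Prop := ∃ U, Hooked (nodes P) U none ∧ Free m U

theorem Stage.mono {m m' : ℕ} {P : Shape → Shape → Prop} (h : Stage m P) (hm : m ≤ m') :
    Stage m' P := by
  obtain ⟨U, h₁, h₂⟩ := h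
  exact ⟨U, h₁, h₂.mono hm⟩

theorem Stage.congr {m : ℕ} {P Q : Shape → Shape → Prop} (h : Stage m P)
    (hPQ : ∀ u v, Q u v ↔ P u v) : Stage m Q := by
  rwa [show Q = P by ext u v; exact hPQ u v]

theorem Stage.joinable {m n : ℕ} (h : Stage m fun u v => u.numNodes + v.numNodes = n) :
    Joinable (n + 1) := by
  obtain ⟨U, h₁, h₂⟩ := h
  exact ⟨U, by rwa [ofSize_succ], h₂.1⟩

theorem Block.stage {P : Shape → Shape → Prop} {U V : Set (Shape × Label)} (h : Block P U V) :
    Stage 0 P := ⟨_, h.hooked, h.free⟩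

theorem peak_ne_comb (m n : ℕ) : peak m ≠ comb n := by
  intro h
  have := (comb_eq_node h.symm).1
  cases this

theorem hub_ne_left (n : ℕ) (d x : Shape) (l : Label) : hub n d ≠ (x, left l) := by simp [hub]

theorem hub_ne_closing (n : ℕ) (d x : Shape) : hub n d ≠ (x, closing) := by simp [hub]

theorem hub_ne_opening (n : ℕ) (d x : Shape) : hub n d ≠ (x, opening) := by simp [hub]

theorem hub_ne_right_opening (n : ℕ) (d x : Shape) : hub n d ≠ (x, right opening) := by simp [hub]

theorem Free.insert_hub {m : ℕ} {d : Shape} {U : Set (Shape × Label)} (h : Free m U)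
    (hd : m ≠ 0 ∨ d ≠ nil) : Free (m + 1) (Insert.insert (hub m d) U) := by
  refine (h.mono (Nat.le_succ m)).insert (not_reserved_hub hd) fun n d' hn h => ?_
  simp only [hub, Prod.mk.injEq, node.injEq, true_and, and_true] at h
  have := comb_injective h.1
  omega

section Steps

variable {P Q R S T : Shape → Shape → Prop} {U₂ V₂ U₃ V₃ U₄ V₄ : Set (Shape × Label)} {m : ℕ}

/-- Attaches two blocks by the hyperedge `triple_hub m d`. -/
theorem Stage.join_triple (d : Shape) (hd : Tail d) (hmd : m ≠ 0 ∨ d ≠ nil) (hP : Stage m P)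
    (hQ : Block Q U₂ V₂) (hR : Block R U₃ V₃)
    (mP : P nil (comb m △ (nil △ d))) (mQ : Q (comb (m + 1)) (nil △ d)) (mR : R (peak m) d)
    (dPQ : ∀ u v, P u v → ¬Q u v) (dPR : ∀ u v, P u v → ¬R u v) (dQR : ∀ u v, Q u v → ¬R u v) :
    Stage (m + 1) fun u v => (P u v ∨ Q u v) ∨ R u v := by
  obtain ⟨U, h, hU⟩ := hP
  have := (triple_hub m d).join
    ⟨h, by simpa using mP, hU.2 m d le_rfl hd⟩
    ⟨hQ.hooked, by simpa using mQ, by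
      rw [left_mem_gridUsed]
      exact fun h => hQ.left _ h (.inr (.inr ⟨m, rfl⟩))⟩
    ⟨hR.hooked, by simpa using mR, closing_notMem_gridUsed⟩
    (disjoint_nodes dPQ) (disjoint_nodes dPR) (disjoint_nodes dQR)
  rw [nodes_union, nodes_union] at this
  refine ⟨_, this, ((hU.insert_hub hmd).union ?_).union ?_⟩
  · exact (hQ.free.mono (Nat.zero_le _)).insert (not_reserved_left _ _)
      fun _ _ _ => hub_ne_left _ _ _ _
  · exact (hR.free.mono (Nat.zero_le _)).insert (not_reserved_closing _)
      fun _ _ _ => hub_ne_closing _ _ _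

/-- Attaches three blocks by the hyperedge `quad_hub m`.  -/
theorem Stage.join_quad (hP : Stage m P)
    (hQ : Block Q U₂ V₂) (hR : Block R U₃ V₃) (hS : Block S U₄ ∅)
    (mP : P nil (comb m △ (nil △ comb 1))) (mQ : Q (comb (m + 1)) (nil △ comb 1))
    (mR : R (nil △ peak m) nil) (mS : S (peak m) (comb 1))
    (dPQ : ∀ u v, P u v → ¬Q u v) (dPR : ∀ u v, P u v → ¬R u v) (dQR : ∀ u v, Q u v → ¬R u v)
    (dPS : ∀ u v, P u v → ¬S u v) (dQS : ∀ u v, Q u v → ¬S u v) (dRS : ∀ u v, R u v → ¬S u v) :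
    Stage (m + 1) fun u v => ((P u v ∨ Q u v) ∨ R u v) ∨ S u v := by
  obtain ⟨U, h, hU⟩ := hP
  have := (quad_hub m).join
    ⟨h, by simpa using mP, hU.2 m (comb 1) le_rfl (tail_comb 1)⟩
    ⟨hQ.hooked, by simpa using mQ, by
      rw [left_mem_gridUsed]
      exact fun h => hQ.left _ h (.inr (.inr ⟨m, rfl⟩))⟩
    ⟨hR.hooked, by simpa using mR, closing_notMem_gridUsed⟩
    ⟨hS.hooked, by simpa using mS, by simp⟩
    (disjoint_nodes dPQ) (disjoint_nodes dPR) (disjoint_nodes dQR)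
    (disjoint_nodes dPS) (disjoint_nodes dQS) (disjoint_nodes dRS)
  rw [nodes_union, nodes_union, nodes_union] at this
  refine ⟨_, this, (((hU.insert_hub (.inr (by simp [comb]))).union ?_).union ?_).union ?_⟩
  · exact (hQ.free.mono (Nat.zero_le _)).insert (not_reserved_left _ _)
      fun _ _ _ => hub_ne_left _ _ _ _
  · exact (hR.free.mono (Nat.zero_le _)).insert (not_reserved_closing _)
      fun _ _ _ => hub_ne_closing _ _ _
  · exact (hS.free.mono (Nat.zero_le _)).insert (not_reserved_right_opening fun n => peak_ne_comb m n)
      fun _ _ _ => hub_ne_right_opening _ _ _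

end Steps

/-! ### Starting from the class with empty left subtree -/

section Start

variable {P Q R S : Shape → Shape → Prop} {U₁ V₁ U₂ V₂ V₃ V₄ : Set (Shape × Label)}

theorem unreserved_empty_grid : Unreserved (gridUsed ∅ ∅) := unreserved_empty.free_gridUsed.1

theorem not_reserved_start {d : Shape} (hd : d ≠ nil) :
    ¬Reserved (nil △ (comb 1 △ d), opening) :=
  not_reserved_opening fun _ => not_tail_node (by simp [comb]) (.inr hd)

/-- Attaches three blocks by the hyperedge `quad_start d`.  The statement about first edges allows
one further hyperedge at another tree with empty left subtree. -/
theorem Block.join_quad_start (d : Shape) (hd : d ≠ nil) (hP : Block P U₁ V₁)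
    (hQ : Block Q U₂ V₂) (hR : Block R ∅ V₃) (hS : Block S ∅ V₄)
    (mP : P nil (comb 1 △ d)) (mQ : Q (comb 2) d) (mR : R hook d) (mS : S (comb 1) (nil △ d))
    (dPQ : ∀ u v, P u v → ¬Q u v) (dPR : ∀ u v, P u v → ¬R u v) (dQR : ∀ u v, Q u v → ¬R u v)
    (dPS : ∀ u v, P u v → ¬S u v) (dQS : ∀ u v, Q u v → ¬S u v) (dRS : ∀ u v, R u v → ¬S u v) :
    ∃ U, Hooked (nodes fun u v => ((P u v ∨ Q u v) ∨ R u v) ∨ S u v) U none ∧ Free 0 U ∧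
      ∀ v, v ≠ comb 1 △ d → (nil △ v, opening) ∉ U := by
  have := (quad_start d).join
    ⟨hP.hooked, by simpa using mP, by simp⟩ ⟨hQ.hooked, by simpa using mQ, by simp⟩
    ⟨hR.hooked, by simpa using mR, by simp⟩ ⟨hS.hooked, by simpa using mS, by simp⟩
    (disjoint_nodes dPQ) (disjoint_nodes dPR) (disjoint_nodes dQR)
    (disjoint_nodes dPS) (disjoint_nodes dQS) (disjoint_nodes dRS)
  rw [nodes_union, nodes_union, nodes_union] at this
  refine ⟨_, this, (((?_ : Free 0 _).union ?_).union ?_).union ?_, fun v hv => ?_⟩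
  · exact hP.free.insert (not_reserved_start hd) fun _ _ _ => hub_ne_opening _ _ _
  · exact hQ.free.insert (not_reserved_opening fun h => by simp [comb] at h)
      fun _ _ _ => hub_ne_opening _ _ _
  · exact hR.free.insert (not_reserved_left _ _) fun _ _ _ => hub_ne_left _ _ _ _
  · exact hS.free.insert (not_reserved_left _ _) fun _ _ _ => hub_ne_left _ _ _ _
  · simp only [ne_eq, comb] at hv
    simp [hv, comb]

theorem Block.join_triple_start (d : Shape) (hd : d ≠ nil) (hP : Block P U₁ V₁)
    (hQ : Block Q U₂ V₂) (hR : Block R ∅ V₃)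
    (mP : P nil (comb 1 △ d)) (mQ : Q (comb 2) d) (mR : R hook d)
    (dPQ : ∀ u v, P u v → ¬Q u v) (dPR : ∀ u v, P u v → ¬R u v) (dQR : ∀ u v, Q u v → ¬R u v) :
    Stage 0 fun u v => (P u v ∨ Q u v) ∨ R u v := by
  have := (triple_start d).join
    ⟨hP.hooked, by simpa using mP, by simp⟩ ⟨hQ.hooked, by simpa using mQ, by simp⟩
    ⟨hR.hooked, by simpa using mR, by simp⟩
    (disjoint_nodes dPQ) (disjoint_nodes dPR) (disjoint_nodes dQR)
  rw [nodes_union, nodes_union] at this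
  refine ⟨_, this, ((?_ : Free 0 _).union ?_).union ?_⟩
  · exact hP.free.insert (not_reserved_start hd) fun _ _ _ => hub_ne_opening _ _ _
  · exact hQ.free.insert (not_reserved_opening fun h => by simp [comb] at h)
      fun _ _ _ => hub_ne_opening _ _ _
  · exact hR.free.insert (not_reserved_left _ _) fun _ _ _ => hub_ne_left _ _ _ _

end Start

/-! ### Trees with three or four nodes -/

theorem numNodes_eq_three {x : Shape} : x.numNodes = 3 ↔
    x = comb 3 ∨ x = hook △ nil ∨ x = nil △ hook ∨ x = comb 1 △ comb 1 ∨ x = comb 2 △ nil := by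
  cases x with
  | nil => simp [comb]
  | node _ u v =>
    have : (u.numNodes + v.numNodes + 1 = 3) ↔
      (u.numNodes = 0 ∧ v.numNodes = 2 ∨ u.numNodes = 1 ∧ v.numNodes = 1 ∨
        u.numNodes = 2 ∧ v.numNodes = 0) := by omega
    simp only [numNodes, this, numNodes_eq_zero, numNodes_eq_one, numNodes_eq_two]
    simp only [comb, node.injEq, true_and]
    tauto

/-- The unused edge serves to attach the remaining two trees with three nodes. -/
theorem hooked_three : ∃ U, Hooked {comb 3, hook △ nil, nil △ hook} U none ∧ Unreserved U ∧
    (hook △ nil, left (left opening)) ∉ U := by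
  have := triple_comb_three.join ⟨.single _, rfl, by simp⟩ ⟨.single _, rfl, by simp⟩
    ⟨.single _, rfl, by simp⟩ (by simp [comb, hook]) (by simp [comb, hook]) (by simp [hook])
  refine ⟨_, by convert this using 1; ext; simp; tauto, ?_, by simp⟩
  refine ((unreserved_empty.insert (not_reserved_closing _)).union
    (unreserved_empty.insert (not_reserved_opening ?_))).union
    (unreserved_empty.insert (not_reserved_right_left _ _))
  simp [hook]

theorem joinable_three : Joinable 3 := by
  obtain ⟨U, h, hU, hm⟩ := hooked_three
  have := triple_comb_one_comb_one.join ⟨.single _, rfl, by simp⟩ ⟨.single _, rfl, by simp⟩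
    ⟨h, by simp, hm⟩ (by simp [comb]) (by simp [comb, hook]) (by simp [comb, hook])
  refine ⟨_, by convert this using 1; ext; simp [ofSize, numNodes_eq_three]; tauto, ?_⟩
  exact ((unreserved_empty.insert (not_reserved_right_closing _)).union
    (unreserved_empty.insert (not_reserved_closing _))).union (hU.insert (not_reserved_left _ _))

/-- Five trees with four nodes: the lift of `hooked_three` and two more trees.  The unused edge
serves to attach them to the class with empty left subtree. -/
theorem hooked_four : ∃ U, Hooked (nodes fun u v =>
      (u = comb 1 ∧ v = hook ∨
        u ∈ ({comb 3, hook △ nil, nil △ hook} : Set Shape) ∧ v ∈ ({nil} : Set Shape)) ∨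
      u = comb 1 △ comb 1 ∧ v = nil) U none ∧ Unreserved U ∧
    ((comb 1 △ comb 1) △ nil, opening) ∉ U := by
  obtain ⟨U, h, hU, -⟩ := hooked_three
  have hB := block_of_hooked h hU (.single nil) unreserved_empty (Set.singleton_nonempty _)
    fun _ _ => .rfl
  have hs := (block_single (comb 1) hook).hooked
  have ht := (block_single (comb 1 △ comb 1) nil).hooked
  have := triple_comb_one_hook.join ⟨hs, by simp, by simp⟩ ⟨hB.hooked, by simp, by simp⟩
    ⟨ht, by simp, by simp⟩
    (disjoint_nodes (by simp +contextual [hook]))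
    (disjoint_nodes (by simp +contextual [hook]))
    (disjoint_nodes (by simp +contextual [hook, comb]))
  rw [nodes_union, nodes_union] at this
  refine ⟨_, this, ?_, by simp [comb]⟩
  refine ((unreserved_empty_grid.insert (not_reserved_opening ?_)).union
    (hB.free.1.insert (not_reserved_opening ?_))).union
    (unreserved_empty_grid.insert (not_reserved_left _ _)) <;>
  exact fun h => by simp [comb] at h

theorem joinable_four : Joinable 4 := by
  obtain ⟨V, hV⟩ := block_row nil joinable_three
  have h := hV.join_quad_start (comb 1) (by simp [comb])
    (block_single (comb 2) (comb 1)) (block_single hook (comb 1)) (block_single (comb 1) (comb 2))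
    (by simp) (by simp [comb]) (by simp) (by simp [comb])
    ?_ ?_ ?_ ?_ ?_ ?_
  · obtain ⟨U₁, h₁, hU₁, hm₁⟩ := h
    obtain ⟨U₂, h₂, hU₂, hm₂⟩ := hooked_four
    have hr := (block_single (comb 2 △ nil) nil).hooked
    have := triple_nil_hook_nil.join ⟨h₁, by simp [hook], hm₁ _ (by simp [comb, hook])⟩
      ⟨h₂, by simp, hm₂⟩ ⟨hr, by simp, by simp⟩
      (disjoint_nodes ?_) (disjoint_nodes ?_) (disjoint_nodes ?_)
    · rw [nodes_union, nodes_union] at this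
      rw [Joinable, ofSize_succ 3]
      refine ⟨_, Eq.subst (motive := fun X => Hooked X _ none) (nodes_congr fun u v => ?_) this, ?_⟩
      · have : (u.numNodes + v.numNodes = 3) ↔
          (u.numNodes = 0 ∧ v.numNodes = 3 ∨ u.numNodes = 1 ∧ v.numNodes = 2 ∨
            u.numNodes = 2 ∧ v.numNodes = 1 ∨ u.numNodes = 3 ∧ v.numNodes = 0) := by omega
        simp only [this, numNodes_eq_zero, numNodes_eq_one, numNodes_eq_two,
          numNodes_eq_three (x := u), Set.mem_insert_iff, Set.mem_singleton_iff]
        clear h₁ hU₁ hm₁ h₂ hU₂ hm₂ hr hV this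
        grind
      · refine ((hU₁.1.insert (not_reserved_opening fun _ => not_tail_node (by simp [hook])
          (.inl (hook_ne_comb 1)))).union (hU₂.insert (not_reserved_opening ?_))).union
          (unreserved_empty_grid.insert (not_reserved_left _ _))
        simp
    all_goals
      intro u v
      clear h₁ hU₁ hm₁ h₂ hU₂ hm₂ hr hV
      grind [comb, hook, numNodes_nil, numNodes]
  all_goals grind [numNodes_comb, numNodes_hook, numNodes_nil, hook_ne_comb]

/-! ### The recursion -/

/-- The root of the tree has subtrees with `n` nodes in total, at most `m` of them on the left. -/
def UpTo (n m : ℕ) (u v : Shape) : Prop := u.numNodes + v.numNodes = n ∧ u.numNodes ≤ m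

theorem joinable_five : Joinable 5 := by
  obtain ⟨V₀, hV₀⟩ := block_row nil joinable_four
  obtain ⟨V₁, hV₁⟩ := block_row (comb 1) joinable_three
  obtain ⟨U₂, hU₂⟩ := block_column joinable_four nil
  obtain ⟨U₃, hU₃⟩ := block_column joinable_three (comb 1)
  have h₁ := hV₀.join_triple_start hook (by simp [hook])
    (block_single (comb 2) hook) (block_single hook hook) (by simp) (by simp) (by simp)
    (by simp +contextual [comb]) (by simp +contextual [hook]) (by simp +contextual [hook, comb])
  have h₂ := h₁.join_triple (comb 2) (tail_comb 2) (by simp [comb]) hV₁ (block_single hook (comb 2))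
    (by simp) (by simp [comb]) (by simp [peak, hook]) ?_ ?_ ?_
  have h₃ := h₂.join_quad (block_single (comb 2) (comb 2)) hU₂ hU₃
    (by simp) (by simp [comb]) (by simp) (by simp) ?_ ?_ ?_ ?_ ?_ ?_
  · refine (h₃.congr fun u v => ?_).joinable
    grind [UpTo, numNodes_eq_zero, numNodes_eq_one, numNodes_eq_two]
  all_goals grind [UpTo, numNodes_comb, numNodes_hook, numNodes_nil, hook_ne_comb]

theorem joinable_six : Joinable 6 := by
  obtain ⟨V₀, hV₀⟩ := block_row nil joinable_five
  obtain ⟨V₁, hV₁⟩ := block_row (comb 1) joinable_four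
  obtain ⟨V₂, hV₂⟩ := block_row hook joinable_three
  obtain ⟨V₃, hV₃⟩ := block_row (comb 2) joinable_three
  obtain ⟨U₄, hU₄⟩ := block_column joinable_three hook
  obtain ⟨U₅, hU₅⟩ := block_column joinable_three (comb 2)
  obtain ⟨U₆, hU₆⟩ := block_column joinable_five nil
  obtain ⟨U₇, hU₇⟩ := block_column joinable_four (comb 1)
  have h₁ := hV₀.stage.join_triple (comb 3) (tail_comb 3) (by simp [comb]) hV₁ hV₂
    (by simp) (by simp) (by simp [peak, hook]) ?_ ?_ ?_
  have h₂ := h₁.join_triple hook tail_hook (by simp) hV₃ hU₄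
    (by simp) (by simp) (by simp) ?_ ?_ ?_
  have h₃ := h₂.join_quad hU₅ hU₆ hU₇
    (by simp) (by simp [comb]) (by simp) (by simp) ?_ ?_ ?_ ?_ ?_ ?_
  · refine (h₃.congr fun u v => ?_).joinable
    grind [UpTo, numNodes_eq_zero, numNodes_eq_one, numNodes_eq_two]
  all_goals grind [UpTo, numNodes_comb, numNodes_hook, numNodes_nil, hook_ne_comb]

/-- The first three classes; the class with two nodes on the left comes in two rows. -/
theorem stage_two {n : ℕ} (h₀ : Joinable (n + 2)) (h₁ : Joinable (n + 1)) (h₂ : Joinable n)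
    (hn : n ≠ 0) : Stage 0 (UpTo (n + 2) 2) := by
  obtain ⟨V₀, hV₀⟩ := block_row nil h₀
  obtain ⟨V₁, hV₁⟩ := block_row (comb 2) h₂
  obtain ⟨V₂, hV₂⟩ := block_row hook h₂
  obtain ⟨V₃, hV₃⟩ := block_row (comb 1) h₁
  have h := hV₀.join_quad_start (comb n) (fun h => hn (by simpa using congrArg numNodes h))
    hV₁ hV₂ hV₃ (by simp; omega) (by simp) (by simp) (by simp [add_comm]) ?_ ?_ ?_ ?_ ?_ ?_
  · obtain ⟨U, h, hU, -⟩ := h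
    refine Stage.congr ⟨U, h, hU⟩ fun u v => ?_
    grind [UpTo, numNodes_eq_zero, numNodes_eq_one, numNodes_eq_two]
  all_goals grind [UpTo, numNodes_comb, numNodes_hook, numNodes_nil, hook_ne_comb]

/-- The first four classes, starting with two hubs: the rows of the class with two nodes on the left
are attached by different hyperedges. -/
theorem stage_three {n : ℕ} (h₀ : Joinable (n + 3)) (h₁ : Joinable (n + 2))
    (h₂ : Joinable (n + 1)) (h₃ : Joinable 3) (h₄ : Joinable n) :
    Stage 2 (UpTo (n + 3) 3) := by
  obtain ⟨V₀, hV₀⟩ := block_row nil h₀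
  obtain ⟨V₁, hV₁⟩ := block_row (comb 1) h₁
  obtain ⟨V₂, hV₂⟩ := block_row hook h₂
  obtain ⟨V₃, hV₃⟩ := block_row (comb 2) h₂
  obtain ⟨U₄, V₄, hV₄⟩ := block_grid h₃ h₄
  have h₁ := hV₀.stage.join_triple (comb (n + 1)) (tail_comb _) (by simp [comb]) hV₁ hV₂
    (by simp) (by simp) (by simp [peak, hook]) ?_ ?_ ?_
  have h₂ := h₁.join_triple (comb n) (tail_comb n) (by simp) hV₃ hV₄
    (by simp; omega) (by simp [add_comm]) (by simp) ?_ ?_ ?_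
  · refine h₂.congr fun u v => ?_
    grind [UpTo, numNodes_eq_zero, numNodes_eq_one, numNodes_eq_two]
  all_goals grind [UpTo, numNodes_comb, numNodes_hook, numNodes_nil, hook_ne_comb]

/-- The next two classes. -/
theorem Stage.next {m n : ℕ} (hm : m ≠ 0) (h : Stage m (UpTo (m + 2 + n) m))
    (h₁ : Joinable (m + 1)) (h₂ : Joinable (n + 1)) (h₃ : Joinable (m + 2)) (h₄ : Joinable n) :
    Stage (m + 2) (UpTo (m + 2 + n) (m + 2)) := by
  obtain ⟨U₁, V₁, hV₁⟩ := block_grid h₁ h₂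
  obtain ⟨U₂, V₂, hV₂⟩ := block_grid h₃ h₄
  have := h.join_triple (comb n) (tail_comb n) (.inl hm) hV₁ hV₂
    (by simp [UpTo]; omega) (by simp [add_comm]) (by simp) ?_ ?_ ?_
  · refine (this.congr fun u v => ?_).mono (Nat.le_succ _)
    grind [UpTo]
  all_goals grind [UpTo]

/-- The last four classes.  The class with two nodes on the right comes in two columns: the one of
`hook` is attached by `triple_hub`, the one of `comb 2` by `quad_hub`. -/
theorem Stage.finish {m : ℕ} (hm : m ≠ 0) (h : Stage m (UpTo (m + 4) m))
    (h₁ : Joinable (m + 1)) (h₂ : Joinable 3) (h₃ : Joinable (m + 2)) (h₄ : Joinable (m + 4))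
    (h₅ : Joinable (m + 3)) : Joinable (m + 5) := by
  obtain ⟨U₁, V₁, hV₁⟩ := block_grid h₁ h₂
  obtain ⟨U₂, hU₂⟩ := block_column h₃ hook
  obtain ⟨U₃, hU₃⟩ := block_column h₃ (comb 2)
  obtain ⟨U₄, hU₄⟩ := block_column h₄ nil
  obtain ⟨U₅, hU₅⟩ := block_column h₅ (comb 1)
  have h₁ := h.join_triple hook tail_hook (.inl hm) hV₁ hU₂
    (by simp [UpTo]) (by simp) (by simp) ?_ ?_ ?_
  have h₂ := h₁.join_quad hU₃ hU₄ hU₅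
    (by simp [UpTo]) (by simp [comb]) (by simp) (by simp) ?_ ?_ ?_ ?_ ?_ ?_
  · refine (h₂.congr fun u v => ?_).joinable
    grind [UpTo, numNodes_eq_zero, numNodes_eq_one, numNodes_eq_two]
  all_goals grind [UpTo, numNodes_comb, numNodes_hook, numNodes_nil, hook_ne_comb]

/-- Classes are added two at a time, so the parity of `k` decides how to start. -/
theorem joinable {k : ℕ} (hk : k ≠ 2) : Joinable k := by
  induction k using Nat.strong_induction_on with
  | _ k ih =>
    match k, hk, ih with
    | 0, _, _ => exact joinable_zero
    | 1, _, _ => exact joinable_one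
    | 3, _, _ => exact joinable_three
    | 4, _, _ => exact joinable_four
    | 5, _, _ => exact joinable_five
    | 6, _, _ => exact joinable_six
    | n + 7, _, ih =>
      have ih' (j : ℕ) (h₁ : 3 ≤ j) (h₂ : j ≤ n + 6) : Joinable j := ih j (by omega) (by omega)
      -- `j` counts the remaining pairs of classes
      have step (j m : ℕ) (hm : 2 ≤ m) (hj : m + 2 * j = n + 2)
          (h : Stage m (UpTo (n + 6) m)) : Stage (n + 2) (UpTo (n + 6) (n + 2)) := by
        induction j generalizing m with
        | zero => rwa [show n + 2 = m by omega]
        | succ j ih'' =>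
          obtain ⟨r, hr⟩ : ∃ r, n + 6 = m + 2 + r := ⟨n + 4 - m, by omega⟩
          rw [hr] at h ⊢
          have := h.next (by omega) (ih' _ (by omega) (by omega)) (ih' _ (by omega) (by omega))
            (ih' _ (by omega) (by omega)) (ih' _ (by omega) (by omega))
          rw [← hr] at this ⊢
          exact ih'' (m + 2) (by omega) (by omega) this
      have last : Stage (n + 2) (UpTo (n + 6) (n + 2)) := by
        rcases Nat.even_or_odd' n with ⟨j, hj | hj⟩
        · exact step j 2 le_rfl (by omega) ((stage_two (ih' _ (by omega) le_rfl)
            (ih' _ (by omega) (by omega)) (ih' _ (by omega) (by omega)) (by omega)).mono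
            (Nat.zero_le _))
        · exact step j 3 (by omega) (by omega) ((stage_three (ih' _ (by omega) le_rfl)
            (ih' _ (by omega) (by omega)) (ih' _ (by omega) (by omega)) (ih' 3 le_rfl (by omega))
            (ih' _ (by omega) (by omega))).mono (Nat.le_succ _))
      exact last.finish (by omega) (ih' _ (by omega) (by omega)) (ih' 3 le_rfl (by omega))
        (ih' _ (by omega) (by omega)) (ih' _ (by omega) le_rfl) (ih' _ (by omega) (by omega))

end OddGraph

theorem theorem1 (k : ℕ) (hk : 3 ≤ k) :
    ∃ (v : {s : Finset (Fin (2 * k + 1)) // s.card = k}) (p : (oddGraph k).Walk v v),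
      p.IsHamiltonianCycle := by
  obtain ⟨U, h, -⟩ := OddGraph.joinable (k := k) (by omega)
  exact h.exists_isHamiltonianCycle (by omega)
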